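/- There is a universal constant $C>0$ such that the following holds. Let $X$ be a standard Borel space, $\mathcal D$ a probability distribution on $X$, and $\rho:X\times X\to[0,\infty]$ a measurable cost function (i.e. $\rho(x,x)=0$ for all $x$) of finite degree $d=\sup_{x\in X}|\{y\in X:\rho(x,y)\neq\infty\}|$. Let $n\in\mathbb N$, $\varepsilon>0$, and let $m\ge n$ be any integer with $$m\;\ge\; C\cdot\frac{n^4(\ln d)^2}{\varepsilon^4}.$$ Definitions. For $S\in X^m$ let $\mathcal C_\rho(S)=\{S'\in X^m:\frac1m\sum_{i=1}^m\rho(S_i,S'_i)\le 1\}$, and let $\mathcal C_\rho(\mathcal D)$ be the set of distributions $\mathcal D'$ on $X$ for which there is a coupling of $x\sim\mathcal D$ and $x'\sim\mathcal D'$ with $\mathbb E[\rho(x,x')]\le 1$. An adaptive corruption on $m$ points is the distribution of some $S'\in X^m$ that can be coupled with a clean sample $S\sim\mathcal D^m$ so that $S'\in\mathcal C_\rho(S)$ with probability $1$. Its subsampled version is the distribution on $X^n$ of $n$ points drawn (in random order) uniformly without replacement from $S'$. An oblivious corruption on $n$ points is a product distribution $(\mathcal D')^n$ with $\mathcal D'\in\mathcal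 C_\rho(\mathcal D)$. Finally $d_{\mathrm{TV}}(\mu,\nu)=\sup_T(\mathbb E_\mu[T]-\mathbb E_\nu[T])$ over measurable $T$ with values in $[0,1]$. Claim. For every subsampled adaptive corruption $\mathcal D_{\mathrm{adaptive}}$ there is a randomized oblivious corruption, i.e. a random distribution $\boldsymbol{\mathcal D}_{\mathrm{oblivious}}$ on $X^n$ that is almost surely an oblivious corruption on $n$ points, whose mixture satisfies $$d_{\mathrm{TV}}\bigl(\mathcal D_{\mathrm{adaptive}},\ \mathbb E[\boldsymbol{\mathcal D}_{\mathrm{oblivious}}]\bigr)\le\varepsilon .$$ -/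

import Mathlib

open MeasureTheory
open scoped ENNReal BigOperators

noncomputable section

namespace Corruption

variable {X : Type*}

/-- A cost function on `X`: a map `X × X → [0, ∞]` that vanishes on the diagonal. -/
def IsCostFunction (ρ : X → X → ℝ≥0∞) : Prop :=
  ∀ x, ρ x x = 0

/-- The degree of a cost function: the supremum over `x` of the number of distinct `y` with
`ρ x y ≠ ∞`. -/
def costDegree (ρ : X → X → ℝ≥0∞) : ℕ∞ :=
  ⨆ x : X, {y : X | ρ x y ≠ ∞}.encard

/-- The legal corruptions of a sample `S ∈ X ^ m`: all `S'` whose average cost is at most `1`. -/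
def sampleCorruptions {m : ℕ} (ρ : X → X → ℝ≥0∞) (S : Fin m → X) : Set (Fin m → X) :=
  {S' | (m : ℝ≥0∞)⁻¹ * ∑ i, ρ (S i) (S' i) ≤ 1}

variable [MeasurableSpace X]

/-- `π` is a coupling of `μ` and `ν`. -/
def IsCoupling {Y Z : Type*} [MeasurableSpace Y] [MeasurableSpace Z]
    (π : Measure (Y × Z)) (μ : Measure Y) (ν : Measure Z) : Prop :=
  π.map Prod.fst = μ ∧ π.map Prod.snd = ν

/-- The legal corruptions of a distribution `D`: all `D'` such that some coupling of `x ∼ D` and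
`x' ∼ D'` has expected cost at most `1`. -/
def distributionCorruptions (ρ : X → X → ℝ≥0∞) (D : Measure X) : Set (Measure X) :=
  {D' | ∃ π : Measure (X × X), IsCoupling π D D' ∧ ∫⁻ p, ρ p.1 p.2 ∂π ≤ 1}

/-- The oblivious corruptions on `n` points: the `n`-fold products of the legal corruptions
of `D`. -/
def obliviousCorruptions (n : ℕ) (ρ : X → X → ℝ≥0∞) (D : Measure X) :
    Set (Measure (Fin n → X)) :=
  {E | ∃ D' ∈ distributionCorruptions ρ D, E = Measure.pi (fun _ : Fin n => D')}

/-- The adaptive corruptions on `m` points: the laws of `S'` for which `S'` can be coupled with a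
clean sample `S ∼ D ^ m` so that, almost surely, `S'` is a legal corruption of `S`. -/
def adaptiveCorruptions (m : ℕ) (ρ : X → X → ℝ≥0∞) (D : Measure X) :
    Set (Measure (Fin m → X)) :=
  {E | ∃ π : Measure ((Fin m → X) × (Fin m → X)),
      IsCoupling π (Measure.pi (fun _ : Fin m => D)) E ∧
        ∀ᵐ p ∂π, p.2 ∈ sampleCorruptions ρ p.1}

/-- The subsampling filter from `m` to `n` points applied to the law `E` on `X ^ m`: the law of
`(S (σ 1), …, S (σ n))` where `S ∼ E` and, independently, `σ` is a uniformly random injection of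
`n` indices into `m` indices (`n` ordered draws without replacement). -/
def subsample {m : ℕ} (n : ℕ) (E : Measure (Fin m → X)) : Measure (Fin n → X) :=
  (Fintype.card (Fin n ↪ Fin m) : ℝ≥0∞)⁻¹ •
    ∑ σ : Fin n ↪ Fin m, E.map (fun S i => S (σ i))

/-- The total variation distance of two probability measures: the supremum over measurable tests
`T` with values in `[0, 1]` of the difference of the expectations of `T`. -/
def tvDist {Y : Type*} [MeasurableSpace Y] (μ ν : Measure Y) : ℝ :=
  ⨆ T : {T : Y → ℝ // Measurable T ∧ ∀ y, T y ∈ Set.Icc (0 : ℝ) 1},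
    ((∫ y, T.1 y ∂μ) - ∫ y, T.1 y ∂ν)

end Corruption

end

noncomputable section

namespace Corruption

open ProbabilityTheory InformationTheory

/-! ### Product measures -/

/-! Shuffle the pairs (clean point, corrupted point) of the coupling uniformly. They become
exchangeable, and the subsample is the corrupted half of any `n` of them. The idea is to condition
on the first `k` pairs, for a well chosen `k`, and to show that the next `n` pairs are then nearly
i.i.d. with a law that is nearly a legal corruption of `D`.

Finite degree supplies a reference law. There is a Markov kernel `κ` under which every corruption
that occurs has probability at least `1/d`, so, with `u = D ⊗ₘ κ`, the law of `k` pairs and any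
further clean points is at most `d ^ k` times the product of copies of `u` and `D`. With `L = log d`
this bounds two divergences.

(1) Let `A k` be the divergence of the first `k` pairs from the `k`-fold product of `u`; it is at
most `k L`. Its increment at `k` is the divergence of one further pair given the first `k`. By the
compensation identity `klDiv_prod_pi_eq_add`, the defect `A (k + n) - A k - n (A (k + 1) - A k)` is
exactly the divergence of the next `n` pairs from the mixture of products with the same conditional
one-pair law. The defects telescope when summed over `k` (`sum_increment_defect_le`), so one of the
first `O(n² L / ε²)` is `O(ε²)`, and a Pinsker-type bound applies.

(2) Given the first `k` pairs, the `m - k` other clean points have total divergence at most `k L`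
from a product of copies of `D`, so each has at most `k L / (m - k)`. The conditional one-pair law
thus has first marginal close to `D`, and by exchangeability its expected cost is at most `m / (m -
k)`. Capping the first marginal at `D`, scaling by `(m - k) / m` and refilling with clean pairs `(x,
x)` makes it legal (`repairedKernel`), at a loss of mass that is paid `n` times.

Taking `k` of order `n² L / ε²`, the demand that `k L / m` be `O(ε² / n²)` gives `m` of order `n⁴ L²
/ ε⁴`. -/

lemma lintegral_pi_prod {ι : Type*} [Fintype ι] {Y : ι → Type*} [∀ i, MeasurableSpace (Y i)]
    (μ : ∀ i, Measure (Y i)) [∀ i, IsProbabilityMeasure (μ i)] {f : ∀ i, Y i → ℝ≥0∞}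
    (hf : ∀ i, Measurable (f i)) :
    ∫⁻ y, ∏ i, f i (y i) ∂(Measure.pi μ) = ∏ i, ∫⁻ y, f i y ∂(μ i) := by
  have hind : iIndepFun (fun i (y : ∀ i, Y i) => f i (y i)) (Measure.pi μ) :=
    iIndepFun_pi (X := fun i => f i) (fun i => (hf i).aemeasurable)
  rw [lintegral_prod_eq_prod_lintegral_of_indepFun Finset.univ _ hind
    (fun i => (hf i).comp (measurable_pi_apply i))]
  refine Finset.prod_congr rfl fun i _ => ?_
  exact (measurePreserving_eval μ i).lintegral_comp (hf i)

lemma pi_withDensity {ι Y : Type*} [Fintype ι] [MeasurableSpace Y]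
    (μ : Measure Y) [IsProbabilityMeasure μ] {f : Y → ℝ≥0∞} (hf : Measurable f)
    [IsFiniteMeasure (μ.withDensity f)] :
    Measure.pi (fun _ : ι => μ.withDensity f)
      = (Measure.pi (fun _ : ι => μ)).withDensity (fun y => ∏ i, f (y i)) := by
  refine Measure.pi_eq fun s hs => ?_
  have h1 : ∀ y : ι → Y, (Set.univ.pi s).indicator (fun y => ∏ i, f (y i)) y
      = ∏ i, (s i).indicator f (y i) := by
    intro y
    classical
    by_cases hy : y ∈ Set.univ.pi s
    · rw [Set.indicator_of_mem hy]
      exact Finset.prod_congr rfl fun i _ => (Set.indicator_of_mem (hy i trivial) f).symm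
    · rw [Set.indicator_of_notMem hy]
      simp only [Set.mem_pi, Set.mem_univ, true_imp_iff, not_forall] at hy
      obtain ⟨i, hi⟩ := hy
      exact (Finset.prod_eq_zero (Finset.mem_univ i) (Set.indicator_of_notMem hi f)).symm
  rw [withDensity_apply _ (MeasurableSet.univ_pi hs),
    ← lintegral_indicator (MeasurableSet.univ_pi hs)]
  simp_rw [h1]
  rw [lintegral_pi_prod (fun _ : ι => μ) (fun i => hf.indicator (hs i))]
  refine Finset.prod_congr rfl fun i _ => ?_
  rw [lintegral_indicator (hs i), withDensity_apply _ (hs i)]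

lemma pi_mono_measure {ι Y : Type*} [Fintype ι] [MeasurableSpace Y]
    {μ ν : Measure Y} [IsProbabilityMeasure ν] (h : μ ≤ ν) :
    Measure.pi (fun _ : ι => μ) ≤ Measure.pi (fun _ : ι => ν) := by
  have : IsFiniteMeasure μ := isFiniteMeasure_of_le ν h
  have hac : μ ≪ ν := Measure.absolutelyContinuous_of_le h
  -- Truncating the density at 1 makes the bound hold everywhere, so it passes to finite products
  -- pointwise.
  set f := fun y => min (μ.rnDeriv ν y) 1 with hf
  have hfm : Measurable f := (Measure.measurable_rnDeriv μ ν).min measurable_const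
  have hle : μ.rnDeriv ν ≤ᵐ[ν] fun _ => 1 := by
    refine ae_le_of_forall_setLIntegral_le_of_sigmaFinite (Measure.measurable_rnDeriv μ ν) ?_
    intro s hs _
    rw [Measure.setLIntegral_rnDeriv hac]
    simpa using h s
  have hμ : μ = ν.withDensity f := by
    conv_lhs => rw [← Measure.withDensity_rnDeriv_eq μ ν hac]
    refine withDensity_congr_ae ?_
    filter_upwards [hle] with y hy
    simp [hf, hy]
  have : IsFiniteMeasure (ν.withDensity f) := hμ ▸ this
  rw [hμ, pi_withDensity ν hfm]
  calc _ ≤ (Measure.pi (fun _ : ι => ν)).withDensity 1 :=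
        withDensity_mono (ae_of_all _ fun y => Finset.prod_le_one' fun i _ => min_le_right _ _)
    _ = _ := withDensity_one

/-- The kernel sending `z` to the product of the measures `κ i z`. -/
def piKernel {Z ι Y : Type*} [Fintype ι] [MeasurableSpace Y] [MeasurableSpace Z]
    (κ : ι → Kernel Z Y) [∀ i, IsMarkovKernel (κ i)] : Kernel Z (ι → Y) where
  toFun z := Measure.pi (fun i => κ i z)
  measurable' := by
    refine Measurable.measure_of_isPiSystem_of_isProbabilityMeasure generateFrom_pi.symm
      isPiSystem_pi ?_
    rintro _ ⟨s, hs, rfl⟩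
    simp only [Measure.pi_pi]
    exact Finset.measurable_fun_prod _ fun i _ => (κ i).measurable_coe (hs i trivial)

lemma piKernel_apply {Z ι Y : Type*} [Fintype ι] [MeasurableSpace Y] [MeasurableSpace Z]
    (κ : ι → Kernel Z Y) [∀ i, IsMarkovKernel (κ i)] (z : Z) :
    piKernel κ z = Measure.pi (fun i => κ i z) := rfl

instance {Z ι Y : Type*} [Fintype ι] [MeasurableSpace Y] [MeasurableSpace Z]
    (κ : ι → Kernel Z Y) [∀ i, IsMarkovKernel (κ i)] : IsMarkovKernel (piKernel κ) :=
  ⟨fun z => by rw [piKernel_apply]; infer_instance⟩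

/-! ### Kullback–Leibler divergence -/

/-- With `x = s ^ 2`, `klFun` dominates the Hellinger term `(s - 1) ^ 2`, while AM-GM splits `|s -
1| (s + 1)` with weight `t`. Leaving `t` free avoids square roots in all later estimates. -/
lemma abs_sub_one_le_klFun {x t : ℝ} (hx : 0 ≤ x) (ht : 0 < t) :
    |x - 1| ≤ klFun x / t + t / 2 * (x + 1) := by
  obtain ⟨s, hs, rfl⟩ : ∃ s : ℝ, 0 ≤ s ∧ x = s ^ 2 := ⟨√x, Real.sqrt_nonneg x, (Real.sq_sqrt hx).symm⟩
  have h1 : (s - 1) ^ 2 ≤ klFun (s ^ 2) := by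
    rw [klFun_apply, Real.log_pow]
    rcases hs.eq_or_lt with rfl | hs
    · simp
    have := Real.one_sub_inv_le_log_of_pos hs
    have h2 : s ^ 2 * (1 - s⁻¹) = s ^ 2 - s := by field_simp
    have := mul_le_mul_of_nonneg_left this (sq_nonneg s)
    push_cast
    nlinarith
  have h2 : |s ^ 2 - 1| ≤ (s - 1) ^ 2 / t + t / 4 * (s + 1) ^ 2 := by
    have h3 : (s - 1) ^ 2 / t + t / 4 * (s + 1) ^ 2 - (s - 1) * (s + 1)
        = ((s - 1) - t / 2 * (s + 1)) ^ 2 / t := by field_simp; ring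
    have h4 : (s - 1) ^ 2 / t + t / 4 * (s + 1) ^ 2 + (s - 1) * (s + 1)
        = ((s - 1) + t / 2 * (s + 1)) ^ 2 / t := by field_simp; ring
    have h5 : 0 ≤ ((s - 1) - t / 2 * (s + 1)) ^ 2 / t := by positivity
    have h6 : 0 ≤ ((s - 1) + t / 2 * (s + 1)) ^ 2 / t := by positivity
    rw [abs_le]
    constructor <;> nlinarith
  have h3 : (s - 1) ^ 2 / t ≤ klFun (s ^ 2) / t := by gcongr
  nlinarith [mul_nonneg ht.le (sq_nonneg (s - 1))]

lemma lintegral_dist_one_rnDeriv_le {Ω : Type*} [MeasurableSpace Ω] (μ ν : Measure Ω)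
    [IsProbabilityMeasure μ] [IsProbabilityMeasure ν] (h : μ ≪ ν) {t : ℝ} (ht : 0 < t) :
    ∫⁻ x, ENNReal.ofReal |(μ.rnDeriv ν x).toReal - 1| ∂ν
      ≤ klDiv μ ν * ENNReal.ofReal t⁻¹ + ENNReal.ofReal t := by
  calc ∫⁻ x, ENNReal.ofReal |(μ.rnDeriv ν x).toReal - 1| ∂ν
      ≤ ∫⁻ x, (ENNReal.ofReal (klFun (μ.rnDeriv ν x).toReal) * ENNReal.ofReal t⁻¹
          + ENNReal.ofReal (t / 2) * (μ.rnDeriv ν x + 1)) ∂ν := by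
        refine lintegral_mono_ae ?_
        filter_upwards [Measure.rnDeriv_lt_top μ ν] with x hx
        have h0 : 0 ≤ (μ.rnDeriv ν x).toReal := ENNReal.toReal_nonneg
        have h1 := klFun_nonneg h0
        have h2 : μ.rnDeriv ν x + 1 = ENNReal.ofReal ((μ.rnDeriv ν x).toReal + 1) := by
          rw [ENNReal.ofReal_add h0 zero_le_one, ENNReal.ofReal_toReal hx.ne, ENNReal.ofReal_one]
        rw [h2, ← ENNReal.ofReal_mul h1, ← ENNReal.ofReal_mul (by positivity),
          ← ENNReal.ofReal_add (by positivity) (by positivity)]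
        exact ENNReal.ofReal_le_ofReal (abs_sub_one_le_klFun h0 ht)
    _ = klDiv μ ν * ENNReal.ofReal t⁻¹ + ENNReal.ofReal t := by
        have hm := Measure.measurable_rnDeriv μ ν
        have hk : Measurable fun x => ENNReal.ofReal (klFun (μ.rnDeriv ν x).toReal) :=
          (measurable_klFun.comp hm.ennreal_toReal).ennreal_ofReal
        rw [lintegral_add_left (hk.mul_const _), lintegral_mul_const _ hk,
          klDiv_eq_lintegral_klFun_of_ac h, lintegral_const_mul _ (hm.add_const _),
          lintegral_add_left hm, Measure.lintegral_rnDeriv h]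
        simp only [lintegral_const, measure_univ, mul_one]
        congr 1
        rw [← ENNReal.ofReal_one, ← ENNReal.ofReal_add zero_le_one zero_le_one,
          ← ENNReal.ofReal_mul (by positivity)]
        congr 1; ring

lemma absolutelyContinuous_of_klDiv_ne_top {Ω : Type*} [MeasurableSpace Ω] {μ ν : Measure Ω}
    (h : klDiv μ ν ≠ ∞) : μ ≪ ν := (klDiv_ne_top_iff.1 h).1

/-- A weak form of Pinsker's inequality, for tests with values in `[0, 1]`. -/
lemma lintegral_le_add_klDiv {Ω : Type*} [MeasurableSpace Ω] (μ ν : Measure Ω)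
    [IsProbabilityMeasure μ] [IsProbabilityMeasure ν] {t : ℝ} (ht : 0 < t)
    {T : Ω → ℝ≥0∞} (hT : Measurable T) (hT1 : ∀ x, T x ≤ 1) :
    ∫⁻ x, T x ∂μ ≤ ∫⁻ x, T x ∂ν + (klDiv μ ν * ENNReal.ofReal t⁻¹ + ENNReal.ofReal t) := by
  by_cases htop : klDiv μ ν = ∞
  · rw [htop, ENNReal.top_mul (by simpa using ht)]; simp
  have h := absolutelyContinuous_of_klDiv_ne_top htop
  refine le_trans ?_ (add_le_add_right (lintegral_dist_one_rnDeriv_le μ ν h ht) _)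
  rw [← lintegral_add_left hT, ← lintegral_rnDeriv_mul h hT.aemeasurable]
  refine lintegral_mono_ae ?_
  filter_upwards [Measure.rnDeriv_lt_top μ ν] with x hx
  calc μ.rnDeriv ν x * T x
      ≤ (1 + ENNReal.ofReal |(μ.rnDeriv ν x).toReal - 1|) * T x := by
        gcongr
        rw [← ENNReal.ofReal_one, ← ENNReal.ofReal_add zero_le_one (abs_nonneg _)]
        conv_lhs => rw [← ENNReal.ofReal_toReal hx.ne]
        exact ENNReal.ofReal_le_ofReal (by linarith [le_abs_self ((μ.rnDeriv ν x).toReal - 1)])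
    _ ≤ T x + ENNReal.ofReal |(μ.rnDeriv ν x).toReal - 1| := by
        rw [add_mul, one_mul]
        gcongr
        exact mul_le_of_le_one_right' (hT1 x)

lemma klDiv_le_of_le_smul {Ω : Type*} [MeasurableSpace Ω] (μ ν : Measure Ω)
    [IsProbabilityMeasure μ] [IsProbabilityMeasure ν] {C : ℝ} (hC : 1 ≤ C)
    (h : μ ≤ ENNReal.ofReal C • ν) : klDiv μ ν ≤ ENNReal.ofReal (Real.log C) := by
  have hac : μ ≪ ν := Measure.absolutelyContinuous_of_le_smul h
  have hle : μ.rnDeriv ν ≤ᵐ[ν] fun _ => ENNReal.ofReal C := by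
    refine ae_le_of_forall_setLIntegral_le_of_sigmaFinite (Measure.measurable_rnDeriv μ ν) ?_
    intro s hs _
    rw [Measure.setLIntegral_rnDeriv hac]
    simpa using h s
  have hmk : Measurable fun x => klFun (μ.rnDeriv ν x).toReal :=
    measurable_klFun.comp (Measure.measurable_rnDeriv μ ν).ennreal_toReal
  have hlogle : ∀ x : ℝ≥0∞, x ≤ ENNReal.ofReal C → Real.log x.toReal ≤ Real.log C := by
    intro x hx
    have hx' : x.toReal ≤ C := ENNReal.toReal_le_of_le_ofReal (by linarith) hx
    rcases (ENNReal.toReal_nonneg (a := x)).eq_or_lt with h0 | h0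
    · rw [← h0, Real.log_zero]; exact Real.log_nonneg hC
    · exact Real.log_le_log h0 hx'
  have hint : Integrable (llr μ ν) μ := by
    rw [← integrable_klFun_rnDeriv_iff hac]
    refine Integrable.of_bound hmk.aestronglyMeasurable (C * Real.log C + 1) ?_
    filter_upwards [hle] with x hx
    have h0 : 0 ≤ (μ.rnDeriv ν x).toReal := ENNReal.toReal_nonneg
    have hx' : (μ.rnDeriv ν x).toReal ≤ C := ENNReal.toReal_le_of_le_ofReal (by linarith) hx
    rw [Real.norm_eq_abs, abs_of_nonneg (klFun_nonneg h0), klFun_apply]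
    have := mul_le_mul_of_nonneg_left (hlogle _ hx) h0
    have := mul_le_mul_of_nonneg_right hx' (Real.log_nonneg hC)
    linarith
  rw [← ENNReal.ofReal_toReal (klDiv_ne_top hac hint),
    toReal_klDiv_of_measure_eq hac (by simp)]
  refine ENNReal.ofReal_le_ofReal ?_
  calc ∫ a, llr μ ν a ∂μ ≤ ∫ _, Real.log C ∂μ := by
        refine integral_mono_ae hint (integrable_const _) ?_
        filter_upwards [hac.ae_le hle] with x hx
        exact hlogle _ hx
    _ = Real.log C := by simp

/-- The chain rule, with the second reference law viewed as a constant kernel. -/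
lemma klDiv_prod_eq_add {A B : Type*} [MeasurableSpace A] [MeasurableSpace B]
    [StandardBorelSpace B] [Nonempty B] (M : Measure (A × B)) [IsProbabilityMeasure M]
    (α : Measure A) (β : Measure B) [IsProbabilityMeasure α] [IsProbabilityMeasure β] :
    klDiv M (α.prod β) = klDiv (M.map Prod.fst) α + klDiv M ((M.map Prod.fst).prod β) := by
  have h := klDiv_compProd_eq_add M.fst α M.condKernel (Kernel.const A β)
  rwa [M.disintegrate, Measure.compProd_const, Measure.compProd_const] at h

lemma klDiv_map_measurableEquiv {A B : Type*} [MeasurableSpace A] [MeasurableSpace B]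
    (μ ν : Measure A) [IsFiniteMeasure μ] [IsFiniteMeasure ν] (e : A ≃ᵐ B) :
    klDiv (μ.map e) (ν.map e) = klDiv μ ν := by
  refine le_antisymm (klDiv_map_le μ ν e.measurable) ?_
  have h := klDiv_map_le (μ.map e) (ν.map e) e.symm.measurable
  simpa using h

lemma isProbabilityMeasure_withDensity_of_lintegral_eq_one {Ω : Type*} [MeasurableSpace Ω]
    {μ : Measure Ω} {f : Ω → ℝ≥0∞} (h : ∫⁻ x, f x ∂μ = 1) :
    IsProbabilityMeasure (μ.withDensity f) :=
  ⟨by rw [withDensity_apply _ .univ, Measure.restrict_univ, h]⟩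

lemma map_prod_eval {A B ι : Type*} [MeasurableSpace A] [MeasurableSpace B] [Fintype ι]
    (M₀ : Measure A) (β : Measure B) [IsProbabilityMeasure M₀] [IsProbabilityMeasure β] (i : ι) :
    (M₀.prod (Measure.pi fun _ : ι => β)).map (fun p => (p.1, p.2 i)) = M₀.prod β :=
  ((MeasurePreserving.id M₀).prod (measurePreserving_eval (fun _ : ι => β) i)).map_eq

lemma lintegral_prod_pi_density {A B ι : Type*} [MeasurableSpace A] [MeasurableSpace B] [Fintype ι]
    (M₀ : Measure A) (β : Measure B) [IsProbabilityMeasure M₀] [IsProbabilityMeasure β]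
    {φ : A × B → ℝ≥0∞} (hφ : Measurable φ) :
    ∫⁻ p, ∏ i, φ (p.1, p.2 i) ∂(M₀.prod (Measure.pi fun _ : ι => β))
      = ∫⁻ a, (∫⁻ b, φ (a, b) ∂β) ^ Fintype.card ι ∂M₀ := by
  rw [lintegral_prod _ (by fun_prop)]
  refine lintegral_congr fun a => ?_
  have := lintegral_pi_prod (fun _ : ι => β) (f := fun _ b => φ (a, b)) (fun _ => by fun_prop)
  simpa using this

lemma isProbabilityMeasure_prod_pi_density {A B ι : Type*} [MeasurableSpace A] [MeasurableSpace B]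
    [Fintype ι] (M₀ : Measure A) (β : Measure B) [IsProbabilityMeasure M₀] [IsProbabilityMeasure β]
    {φ : A × B → ℝ≥0∞} (hφ : Measurable φ) (h1 : ∀ᵐ a ∂M₀, ∫⁻ b, φ (a, b) ∂β = 1) :
    IsProbabilityMeasure ((M₀.prod (Measure.pi fun _ : ι => β)).withDensity
      (fun p => ∏ i, φ (p.1, p.2 i))) := by
  refine isProbabilityMeasure_withDensity_of_lintegral_eq_one ?_
  rw [lintegral_prod_pi_density M₀ β hφ]
  calc _ = ∫⁻ _, 1 ∂M₀ := by
        refine lintegral_congr_ae ?_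
        filter_upwards [h1] with a ha
        rw [ha, one_pow]
    _ = 1 := by simp

/-- The compensation identity: the divergence of `M` from `M₀ ⊗ β ^ ι` splits into the divergence
from the mixture of products with the same one-point marginals and the divergences of the
one-point marginals. -/
lemma klDiv_prod_pi_eq_add {A B ι : Type*} [MeasurableSpace A] [MeasurableSpace B] [Fintype ι]
    (M₀ : Measure A) (β : Measure B) [IsProbabilityMeasure M₀] [IsProbabilityMeasure β]
    (M : Measure (A × (ι → B))) [IsProbabilityMeasure M] {φ : A × B → ℝ≥0∞} (hφ : Measurable φ)
    (h1 : ∀ᵐ a ∂M₀, ∫⁻ b, φ (a, b) ∂β = 1)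
    (hmarg : ∀ i, M.map (fun p => (p.1, p.2 i)) = (M₀.prod β).withDensity φ)
    (hfin : klDiv M (M₀.prod (Measure.pi fun _ => β)) ≠ ∞) :
    klDiv M ((M₀.prod (Measure.pi fun _ => β)).withDensity (fun p => ∏ i, φ (p.1, p.2 i)))
      + ∑ _i : ι, klDiv ((M₀.prod β).withDensity φ) (M₀.prod β)
      = klDiv M (M₀.prod (Measure.pi fun _ => β)) := by
  set ν := M₀.prod (Measure.pi fun _ : ι => β) with hν
  set γ : A × (ι → B) → ℝ≥0∞ := fun p => ∏ i, φ (p.1, p.2 i) with hγ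
  set M₁ := (M₀.prod β).withDensity φ with hM₁
  have hγm : Measurable γ := by fun_prop
  have hG : IsProbabilityMeasure (ν.withDensity γ) :=
    isProbabilityMeasure_prod_pi_density M₀ β hφ h1
  have hP1 : IsProbabilityMeasure M₁ := by
    refine isProbabilityMeasure_withDensity_of_lintegral_eq_one ?_
    rw [lintegral_prod _ (by fun_prop), lintegral_congr_ae h1]
    simp
  obtain ⟨hac, hint⟩ := klDiv_ne_top_iff.1 hfin
  set ψ := M.rnDeriv ν with hψ
  have hψm : Measurable ψ := Measure.measurable_rnDeriv M ν
  have hMψ : ν.withDensity ψ = M := Measure.withDensity_rnDeriv_eq M ν hac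
  have hgm : ∀ i, Measurable (fun p : A × (ι → B) => (p.1, p.2 i)) := fun i => by fun_prop
  have hφtop : ∀ᵐ q ∂(M₀.prod β), φ q < ∞ := by
    refine ae_lt_top hφ ?_
    rw [lintegral_prod _ (by fun_prop), lintegral_congr_ae h1]
    simp
  have hac1 : M₁ ≪ M₀.prod β := withDensity_absolutelyContinuous _ _
  have hφpos : ∀ᵐ q ∂M₁, φ q ≠ 0 ∧ φ q ≠ ∞ := by
    have h0 : ∀ᵐ q ∂M₁, φ q ≠ 0 := by
      rw [hM₁, ae_withDensity_iff hφ]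
      exact ae_of_all _ fun _ h => h
    filter_upwards [h0, hac1.ae_le hφtop] with q h h' using ⟨h, h'.ne⟩
  -- Each one-point marginal of `M` has density `φ`, hence does not charge the zeros of `φ`.
  have hφi : ∀ᵐ p ∂M, ∀ i, φ (p.1, p.2 i) ≠ 0 ∧ φ (p.1, p.2 i) ≠ ∞ := by
    rw [ae_all_iff]
    intro i
    have := hφpos
    rw [← hmarg i] at this
    exact ae_of_ae_map (hgm i).aemeasurable this
  have hγ0 : ∀ᵐ p ∂M, γ p ≠ 0 ∧ γ p ≠ ∞ := by
    filter_upwards [hφi] with p hp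
    exact ⟨Finset.prod_ne_zero_iff.2 fun i _ => (hp i).1, ENNReal.prod_ne_top fun i _ => (hp i).2⟩
  -- Dividing by `γ` is legitimate because `γ` is nonzero and finite almost everywhere on the set
  -- where `ψ` is nonzero.
  have hMG : M = (ν.withDensity γ).withDensity (fun p => ψ p * (γ p)⁻¹) := by
    rw [← withDensity_mul _ hγm (by fun_prop), ← hMψ]
    refine withDensity_congr_ae ?_
    have := hγ0
    rw [← hMψ, ae_withDensity_iff hψm] at this
    filter_upwards [this] with p hp
    by_cases h0 : ψ p = 0
    · simp [h0]
    · simp only [Pi.mul_apply]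
      rw [mul_left_comm, ENNReal.mul_inv_cancel (hp h0).1 (hp h0).2, mul_one]
  have hacG : M ≪ ν.withDensity γ := by
    conv_lhs => rw [hMG]
    exact withDensity_absolutelyContinuous _ _
  have hrn : M.rnDeriv (ν.withDensity γ) =ᵐ[M] fun p => ψ p * (γ p)⁻¹ := by
    have := Measure.rnDeriv_withDensity (ν.withDensity γ) (f := fun p => ψ p * (γ p)⁻¹)
      (by fun_prop)
    rw [← hMG] at this
    exact hacG.ae_le this
  have hrn1 : llr M₁ (M₀.prod β) =ᵐ[M₁] fun q => Real.log (φ q).toReal := by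
    filter_upwards [hac1.ae_le (Measure.rnDeriv_withDensity (M₀.prod β) hφ)] with q hq
    rw [llr, hq]
  -- Data processing: a one-point marginal has no larger divergence than `M`.
  have hfin1 : ∀ i : ι, klDiv M₁ (M₀.prod β) ≠ ∞ := by
    intro i
    refine ne_top_of_le_ne_top hfin ?_
    rw [← hmarg i, ← map_prod_eval M₀ β i]
    exact klDiv_map_le M ν (hgm i)
  have hlogm : Measurable fun q => Real.log (φ q).toReal :=
    Real.measurable_log.comp hφ.ennreal_toReal
  have hinti : ∀ i, Integrable (fun p => Real.log (φ (p.1, p.2 i)).toReal) M := by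
    intro i
    have := ((klDiv_ne_top_iff.1 (hfin1 i)).2.congr hrn1)
    rw [← hmarg i] at this
    exact this.comp_measurable (hgm i)
  have hvali : ∀ i, ∫ p, Real.log (φ (p.1, p.2 i)).toReal ∂M
      = (klDiv M₁ (M₀.prod β)).toReal := by
    intro i
    rw [toReal_klDiv_of_measure_eq hac1 (by simp), integral_congr_ae hrn1, ← hmarg i,
      integral_map (hgm i).aemeasurable hlogm.aestronglyMeasurable]
  -- The correction is a sum of functions of one coordinate each, so its integral depends on `M`
  -- only through the one-point marginals.
  have hllr : llr M (ν.withDensity γ) =ᵐ[M]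
      fun p => llr M ν p - ∑ i, Real.log (φ (p.1, p.2 i)).toReal := by
    filter_upwards [hrn, hφi, hγ0, Measure.rnDeriv_pos hac, hac.ae_le (Measure.rnDeriv_lt_top M ν)]
      with p hp hφp hγp hpos hlt
    rw [llr, hp, llr, ENNReal.toReal_mul, ENNReal.toReal_inv, Real.log_mul, Real.log_inv,
      hγ, ENNReal.toReal_prod, Real.log_prod, sub_eq_add_neg]
    · exact fun i _ => ENNReal.toReal_ne_zero.2 (hφp i)
    · exact ENNReal.toReal_ne_zero.2 ⟨hpos.ne', hlt.ne⟩
    · exact inv_ne_zero (ENNReal.toReal_ne_zero.2 hγp)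
  have hintG : Integrable (llr M (ν.withDensity γ)) M :=
    (hint.sub (integrable_finsetSum _ fun i _ => hinti i)).congr hllr.symm
  have hfinG := klDiv_ne_top hacG hintG
  have hsum : ∑ _i : ι, klDiv M₁ (M₀.prod β) ≠ ∞ := ENNReal.sum_ne_top.2 fun i _ => hfin1 i
  rw [← ENNReal.toReal_eq_toReal_iff' (ENNReal.add_ne_top.2 ⟨hfinG, hsum⟩) hfin,
    ENNReal.toReal_add hfinG hsum, ENNReal.toReal_sum (fun i _ => hfin1 i),
    toReal_klDiv_of_measure_eq hacG (by simp), toReal_klDiv_of_measure_eq hac (by simp),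
    integral_congr_ae hllr, integral_sub hint (integrable_finsetSum _ fun i _ => hinti i),
    integral_finsetSum _ fun i _ => hinti i]
  simp only [hvali]
  ring

lemma exists_density_of_klDiv_ne_top {A B : Type*} [MeasurableSpace A] [MeasurableSpace B]
    (M : Measure (A × B)) [IsProbabilityMeasure M] (β : Measure B) [IsProbabilityMeasure β]
    (h : klDiv M ((M.map Prod.fst).prod β) ≠ ∞) :
    ∃ φ : A × B → ℝ≥0∞, Measurable φ ∧ M = ((M.map Prod.fst).prod β).withDensity φ ∧
      ∀ᵐ a ∂(M.map Prod.fst), ∫⁻ b, φ (a, b) ∂β = 1 := by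
  have : IsProbabilityMeasure (M.map Prod.fst) :=
    Measure.isProbabilityMeasure_map measurable_fst.aemeasurable
  have hac := absolutelyContinuous_of_klDiv_ne_top h
  have hm := Measure.measurable_rnDeriv M ((M.map Prod.fst).prod β)
  refine ⟨M.rnDeriv _, hm, (Measure.withDensity_rnDeriv_eq _ _ hac).symm, ?_⟩
  -- Integrating the density over `s ×ˢ univ` recovers the first marginal of `s`, so the fibre
  -- integrals equal 1 almost everywhere.
  refine ae_eq_of_forall_setLIntegral_eq_of_sigmaFinite
    (f := fun a => ∫⁻ b, M.rnDeriv ((M.map Prod.fst).prod β) (a, b) ∂β) (g := fun _ => 1)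
    hm.lintegral_prod_right' measurable_const ?_
  intro s hs _
  have h1 : M (s ×ˢ Set.univ) = M.map Prod.fst s := by
    rw [Measure.map_apply measurable_fst hs, Set.prod_univ]
  rw [setLIntegral_one, ← h1, ← Measure.setLIntegral_rnDeriv hac,
    setLIntegral_prod _ hm.aemeasurable]
  simp

/-! ### Domination by a kernel with atoms of bounded size -/

lemma measurable_kernel_singleton {A X : Type*} [MeasurableSpace A] [MeasurableSpace X]
    [StandardBorelSpace X] (κ : Kernel A X) [IsSFiniteKernel κ] :
    Measurable (fun p : A × X => κ p.1 {p.2}) := by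
  have hd : MeasurableSet {q : (A × X) × X | q.2 = q.1.2} :=
    measurableSet_eq_fun measurable_snd (measurable_snd.comp measurable_fst)
  exact Kernel.measurable_kernel_prodMk_left (κ := κ.comap Prod.fst measurable_fst) hd

/-- A law on `X × X` that charges at most `d` points in each fibre is dominated, fibrewise, by a
Markov kernel whose relevant atoms have mass at least `1 / d`. -/
lemma exists_kernel_le_singleton {X : Type*} [MeasurableSpace X] [StandardBorelSpace X]
    (Q : Measure (X × X)) [IsProbabilityMeasure Q] {S : Set (X × X)}
    (hQ : ∀ᵐ p ∂Q, p ∈ S) {d : ℕ} (hd : ∀ x, {y | (x, y) ∈ S}.encard ≤ d) :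
    ∃ κ : Kernel X X, IsMarkovKernel κ ∧ ∀ᵐ p ∂Q, (d : ℝ≥0∞)⁻¹ ≤ κ p.1 {p.2} := by
  have hne : Nonempty X := by
    obtain ⟨p⟩ : Nonempty (X × X) := nonempty_of_isProbabilityMeasure Q
    exact ⟨p.1⟩
  obtain ⟨κ, hκ, hQκ⟩ : ∃ κ : Kernel X X, IsMarkovKernel κ ∧ Q.fst ⊗ₘ κ = Q :=
    ⟨Q.condKernel, inferInstance, Q.disintegrate _⟩
  set a : X → X → ℝ≥0∞ := fun x y => κ x {y} with ha
  have ham : Measurable (fun p : X × X => a p.1 p.2) := measurable_kernel_singleton κ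
  set c : X → ℝ≥0∞ := fun x => ∫⁻ y, (a x y)⁻¹ ∂(κ x) with hc
  have hcm : Measurable c :=
    Measurable.lintegral_kernel_prod_right (f := fun x y => (a x y)⁻¹) ham.inv
  -- For almost every `x` the law `κ x` is finitely supported, `c x` counts its atoms, and this
  -- density makes it uniform on them. The value 1 serves only to keep the kernel Markov on the
  -- exceptional set.
  set f : X → X → ℝ≥0∞ := fun x y => if c x = 0 ∨ c x = ∞ then 1 else (a x y)⁻¹ * (c x)⁻¹ with hf
  have hgood : MeasurableSet {x | c x = 0 ∨ c x = ∞} :=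
    (hcm (measurableSet_singleton 0)).union (hcm (measurableSet_singleton ∞))
  have hfm : Measurable (Function.uncurry f) := by
    refine Measurable.ite (measurable_fst hgood) measurable_const ?_
    exact ham.inv.mul (hcm.comp measurable_fst).inv
  have hlam : IsMarkovKernel (κ.withDensity f) := by
    refine ⟨fun x => ⟨?_⟩⟩
    rw [Kernel.withDensity_apply' _ hfm, setLIntegral_univ]
    by_cases h : c x = 0 ∨ c x = ∞
    · simp [hf, h]
    · simp only [hf, h, if_false]
      have hax : Measurable (a x) := ham.comp measurable_prodMk_left
      rw [lintegral_mul_const (c x)⁻¹ (f := fun y => (a x y)⁻¹) hax.inv]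
      push Not at h
      exact ENNReal.mul_inv_cancel h.1 h.2
  refine ⟨κ.withDensity f, hlam, ?_⟩
  have hae : ∀ᵐ x ∂Q.fst, ∀ᵐ y ∂(κ x), (x, y) ∈ S := by
    rw [← hQκ] at hQ
    exact Measure.ae_ae_of_ae_compProd hQ
  rw [← hQκ]
  refine Measure.ae_compProd_of_ae_ae (measurableSet_le measurable_const
    (measurable_kernel_singleton (κ.withDensity f))) ?_
  filter_upwards [hae] with x hx
  have hax : Measurable (a x) := ham.comp measurable_prodMk_left
  have hfin : {y | (x, y) ∈ S}.Finite := Set.finite_of_encard_le_coe (hd x)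
  set F := hfin.toFinset with hF
  have hFmem : ∀ y, y ∈ F ↔ (x, y) ∈ S := fun y => by simp [hF]
  have hFcard : F.card ≤ d := by
    have := hd x
    rw [hfin.encard_eq_coe_toFinset_card] at this
    exact_mod_cast this
  have hpos : ∀ᵐ y ∂(κ x), a x y ≠ 0 := by
    have h0 : ∀ y ∈ F, ∀ᵐ y' ∂(κ x), y' = y → a x y ≠ 0 := by
      intro y _
      by_cases hy : a x y = 0
      · have : ∀ᵐ y' ∂(κ x), y' ≠ y := by
          rw [ae_iff]; simpa using hy
        filter_upwards [this] with y' hy' h using absurd h hy'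
      · exact ae_of_all _ fun _ _ => hy
    have h1 : ∀ᵐ y' ∂(κ x), ∀ y ∈ F, y' = y → a x y ≠ 0 :=
      (Finset.eventually_all F).2 h0
    filter_upwards [hx, h1] with y hy h
    exact h y ((hFmem y).2 hy) rfl
  have hcle : c x ≤ d := by
    have hr : (κ x).restrict (F : Set X) = κ x :=
      Measure.restrict_eq_self_of_ae_mem (by filter_upwards [hx] with y hy using (hFmem y).2 hy)
    calc c x = ∫⁻ y in (F : Set X), (a x y)⁻¹ ∂(κ x) := by rw [hr]
      _ = ∑ y ∈ F, (a x y)⁻¹ * κ x {y} := lintegral_finset F _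
      _ ≤ ∑ y ∈ F, 1 := Finset.sum_le_sum fun y _ => ENNReal.inv_mul_le_one _
      _ ≤ d := by simpa using hFcard
  have hc0 : c x ≠ 0 := by
    intro h
    replace h := (lintegral_eq_zero_iff (f := fun y => (a x y)⁻¹) hax.inv).1 h
    have hfalse : ∀ᵐ y ∂(κ x), False := by
      filter_upwards [h] with y hy
      simp [ha] at hy
    simp only [ae_iff, not_false_eq_true, Set.ofPred_true, measure_univ, one_ne_zero] at hfalse
  have hctop : c x ≠ ∞ := ne_top_of_le_ne_top (ENNReal.natCast_ne_top d) hcle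
  filter_upwards [hpos] with y hy
  rw [Kernel.withDensity_apply' _ hfm, lintegral_singleton]
  simp only [hf, hc0, hctop, or_self, if_false]
  rw [mul_right_comm, ENNReal.inv_mul_cancel hy (measure_ne_top (κ x) {y}), one_mul]
  exact ENNReal.inv_le_inv.2 hcle

/-- Fibrewise, a set containing one atom of `Λ`-mass at least `c⁻¹` has mass at least 1 under `c •
Λ`, which beats any probability; a set containing none is null for the conditional law of `W`. -/
lemma le_smul_compProd {A B : Type*} [MeasurableSpace A] [MeasurableSpace B]
    [StandardBorelSpace B] [Nonempty B] (W : Measure (A × B)) [IsProbabilityMeasure W]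
    (Λ : Kernel A B) [IsMarkovKernel Λ] {c : ℝ≥0∞} (hc : c ≠ ∞)
    (h : ∀ᵐ p ∂W, c⁻¹ ≤ Λ p.1 {p.2}) : W ≤ c • (W.fst ⊗ₘ Λ) := by
  have hW : W.fst ⊗ₘ W.condKernel = W := W.disintegrate _
  have hae : ∀ᵐ a ∂W.fst, ∀ᵐ b ∂(W.condKernel a), c⁻¹ ≤ Λ a {b} := by
    rw [← hW] at h
    exact Measure.ae_ae_of_ae_compProd h
  refine Measure.le_iff.2 fun s hs => ?_
  conv_lhs => rw [← hW]
  rw [Measure.smul_apply, Measure.compProd_apply hs, Measure.compProd_apply hs, smul_eq_mul,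
    ← lintegral_const_mul _ (Kernel.measurable_kernel_prodMk_left hs)]
  refine lintegral_mono_ae ?_
  filter_upwards [hae] with a ha
  by_cases hex : ∃ b, (a, b) ∈ s ∧ c⁻¹ ≤ Λ a {b}
  · obtain ⟨b, hb, hcb⟩ := hex
    have h1 : 1 ≤ c * Λ a {b} := by
      rcases eq_or_ne c 0 with rfl | h0
      · simp only [ENNReal.inv_zero, top_le_iff] at hcb
        exact absurd hcb (measure_ne_top _ _)
      · calc 1 = c * c⁻¹ := (ENNReal.mul_inv_cancel h0 hc).symm
          _ ≤ _ := by gcongr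
    calc W.condKernel a (Prod.mk a ⁻¹' s) ≤ 1 := prob_le_one
      _ ≤ c * Λ a {b} := h1
      _ ≤ c * Λ a (Prod.mk a ⁻¹' s) := by
          gcongr
          simpa using hb
  · push Not at hex
    have : W.condKernel a (Prod.mk a ⁻¹' s) = 0 := by
      refine measure_mono_null ?_ ha
      intro b hb
      simpa using hex b hb
    rw [this]
    exact zero_le

/-- Pairing two tuples. -/
lemma map_zip_compProd_piKernel {ι X Y : Type*} [Fintype ι] [MeasurableSpace X] [MeasurableSpace Y]
    (D : Measure X) [IsProbabilityMeasure D] (κ : Kernel X Y) [IsMarkovKernel κ] :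
    ((Measure.pi fun _ : ι => D) ⊗ₘ
        piKernel (fun i : ι => κ.comap (fun s : ι → X => s i) (measurable_pi_apply i))).map
      (fun p i => (p.1 i, p.2 i)) = Measure.pi fun _ : ι => D ⊗ₘ κ := by
  symm
  refine Measure.pi_eq fun B hB => ?_
  have hzm : Measurable (fun (p : (ι → X) × (ι → Y)) (i : ι) => (p.1 i, p.2 i)) := by fun_prop
  rw [Measure.map_apply hzm (MeasurableSet.univ_pi hB),
    Measure.compProd_apply (hzm (MeasurableSet.univ_pi hB))]
  have h1 : ∀ s : ι → X, piKernel (fun i : ι => κ.comap (fun s : ι → X => s i)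
      (measurable_pi_apply i)) s
      (Prod.mk s ⁻¹' ((fun (p : (ι → X) × (ι → Y)) (i : ι) => (p.1 i, p.2 i)) ⁻¹' Set.univ.pi B))
      = ∏ i, κ (s i) (Prod.mk (s i) ⁻¹' B i) := by
    intro s
    rw [piKernel_apply]
    have : (Prod.mk s ⁻¹' ((fun (p : (ι → X) × (ι → Y)) (i : ι) => (p.1 i, p.2 i)) ⁻¹'
        Set.univ.pi B)) = Set.univ.pi fun i => Prod.mk (s i) ⁻¹' B i := by
      ext t; simp
    rw [this, Measure.pi_pi]
    rfl
  simp_rw [h1]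
  rw [lintegral_pi_prod (fun _ : ι => D) (f := fun i x => κ x (Prod.mk x ⁻¹' B i))
    (fun i => Kernel.measurable_kernel_prodMk_left (hB i))]
  exact Finset.prod_congr rfl fun i _ => (Measure.compProd_apply (hB i)).symm

/-- The kernel ignores the `R`-coordinate, which therefore stays independent of everything built
from the other two. -/
lemma map_prod_compProd_comap_fst {A R B Y : Type*} [MeasurableSpace A] [MeasurableSpace R]
    [MeasurableSpace B] [MeasurableSpace Y] (α : Measure A) (β : Measure R)
    [IsProbabilityMeasure α] [IsProbabilityMeasure β] (Λ : Kernel A B) [IsMarkovKernel Λ]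
    {g : A × B → Y} (hg : Measurable g) :
    ((α.prod β) ⊗ₘ (Λ.comap Prod.fst measurable_fst)).map (fun p => (g (p.1.1, p.2), p.1.2))
      = ((α ⊗ₘ Λ).map g).prod β := by
  have : IsProbabilityMeasure ((α ⊗ₘ Λ).map g) :=
    Measure.isProbabilityMeasure_map hg.aemeasurable
  have hm : Measurable (fun p : (A × R) × B => (g (p.1.1, p.2), p.1.2)) := by fun_prop
  refine Measure.ext fun s hs => ?_
  have hsr : ∀ y, MeasurableSet (Prod.mk y ⁻¹' s) := fun y => measurable_prodMk_left hs
  rw [Measure.map_apply hm hs, Measure.compProd_apply (hm hs), Measure.prod_apply hs,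
    lintegral_map (measurable_measure_prodMk_left hs) hg,
    Measure.lintegral_compProd (f := fun p => β (Prod.mk (g p) ⁻¹' s))
      ((measurable_measure_prodMk_left hs).comp hg),
    lintegral_prod _ (Kernel.measurable_kernel_prodMk_left (hm hs)).aemeasurable]
  refine lintegral_congr fun a => ?_
  have hs' : MeasurableSet ((fun p : B × R => (g (a, p.1), p.2)) ⁻¹' s) :=
    (by fun_prop : Measurable (fun p : B × R => (g (a, p.1), p.2))) hs
  have e1 := Measure.prod_apply (μ := Λ a) (ν := β) hs'
  rw [Measure.prod_apply_symm hs'] at e1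
  exact e1

/-! ### Random measures -/

/-- Since `p` need not be measurable, `ae_map_iff` does not apply. Instead the joint law of `(f a,
a)` is disintegrated over its first coordinate: almost every `E` then has a good preimage `a`,
equality `f a = E` being tested on a countable generating algebra. -/
lemma ae_map_measure_of_ae {A Y : Type*} [MeasurableSpace A] [StandardBorelSpace A]
    [MeasurableSpace Y] [MeasurableSpace.CountablyGenerated Y] (M₀ : Measure A)
    [IsProbabilityMeasure M₀] {f : A → Measure Y} (hf : Measurable f)
    (hprob : ∀ a, IsProbabilityMeasure (f a)) {p : Measure Y → Prop} (hp : ∀ᵐ a ∂M₀, p (f a)) :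
    ∀ᵐ E ∂(M₀.map f), p E := by
  have : Nonempty A := nonempty_of_isProbabilityMeasure M₀
  have : IsProbabilityMeasure (M₀.map f) := Measure.isProbabilityMeasure_map hf.aemeasurable
  set C := generateSetAlgebra (MeasurableSpace.countableGeneratingSet Y) with hC
  have hCc : C.Countable :=
    countable_generateSetAlgebra (MeasurableSpace.countable_countableGeneratingSet)
  have hCg : ‹MeasurableSpace Y› = MeasurableSpace.generateFrom C := by
    rw [hC, generateFrom_generateSetAlgebra_eq, MeasurableSpace.generateFrom_countableGeneratingSet]
  have hCalg : IsSetAlgebra C := isSetAlgebra_generateSetAlgebra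
  have hCm : ∀ s ∈ C, MeasurableSet s := fun s hs => by
    rw [hCg]; exact MeasurableSpace.measurableSet_generateFrom hs
  set S : Set (Measure Y × A) := {q | ∀ s ∈ C, q.1 s = f q.2 s} with hS
  have hSm : MeasurableSet S := by
    have : S = ⋂ s ∈ C, {q | q.1 s = f q.2 s} := by ext q; simp [hS]
    rw [this]
    refine MeasurableSet.biInter hCc fun s hs => ?_
    exact measurableSet_eq_fun ((Measure.measurable_coe (hCm s hs)).comp measurable_fst)
      ((Measure.measurable_coe (hCm s hs)).comp (hf.comp measurable_snd))
  obtain ⟨s, hsp, hsm, hs0⟩ := exists_measurable_superset_of_null (ae_iff.1 hp)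
  have hjoint : ∀ᵐ q ∂(M₀.map fun a => (f a, a)), q ∈ S ∩ (Prod.snd ⁻¹' sᶜ) := by
    refine (ae_map_iff (p := fun q => q ∈ S ∩ (Prod.snd ⁻¹' sᶜ))
      (hf.prodMk measurable_id).aemeasurable (hSm.inter (measurable_snd hsm.compl))).2 ?_
    filter_upwards [measure_eq_zero_iff_ae_notMem.1 hs0] with a ha
    exact ⟨fun _ _ => rfl, ha⟩
  have hdis : M₀.map f ⊗ₘ condDistrib id f M₀ = M₀.map fun a => (f a, a) :=
    compProd_map_condDistrib aemeasurable_id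
  rw [← hdis] at hjoint
  filter_upwards [Measure.ae_ae_of_ae_compProd hjoint] with E hE
  obtain ⟨a, haS, has⟩ := hE.exists
  have hEa : f a = E := by
    refine ext_of_generate_finite C hCg hCalg.isSetRing.isSetSemiring.isPiSystem ?_ ?_
    · exact fun s hs => (haS s hs).symm
    · exact (haS _ hCalg.univ_mem).symm
  rw [← hEa]
  by_contra h
  exact has (hsp h)

lemma one_le_pow_add_mul_one_sub {w : ℝ≥0∞} (hw : w ≤ 1) (n : ℕ) : 1 ≤ w ^ n + n * (1 - w) := by
  have hwt : w ≠ ∞ := ne_top_of_le_ne_top ENNReal.one_ne_top hw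
  lift w to NNReal using hwt
  have hw' : w ≤ 1 := by exact_mod_cast hw
  have h := one_add_mul_le_pow (a := (w : ℝ) - 1) (by linarith [w.coe_nonneg]) n
  have h2 : (1 : NNReal) ≤ w ^ n + n * (1 - w) := by
    rw [← NNReal.coe_le_coe]
    push_cast [NNReal.coe_sub hw']
    have e : 1 + ((w : ℝ) - 1) = w := by ring
    rw [e] at h
    linarith
  exact_mod_cast h2

/-! ### Repairing the conditional laws -/

section Repair

variable {A X : Type*} [MeasurableSpace X]
  (D : Measure X) (κ : Kernel X X) (φ : A × (X × X) → ℝ≥0∞) (c : ℝ≥0∞)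

/-- The density, with respect to `D`, of the first marginal of the law with density `φ (a, ·)`. -/
def marginalDensity (p : A × X) : ℝ≥0∞ := ∫⁻ t, φ (p.1, (p.2, t)) ∂(κ p.2)

/-- The density of the part of the law with density `φ (a, ·)` whose first marginal fits
below `c • D`. -/
def cappedDensity (p : A × (X × X)) : ℝ≥0∞ :=
  c * (φ p * (max 1 (marginalDensity κ φ (p.1, p.2.1)))⁻¹)

/-- The density of the first marginal of the capped law. -/
def cappedMarginal (p : A × X) : ℝ≥0∞ :=
  c * (marginalDensity κ φ p * (max 1 (marginalDensity κ φ p))⁻¹)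

variable {κ φ c}

lemma cappedDensity_le (hc : c ≤ 1) (p : A × (X × X)) :
    cappedDensity κ φ c p ≤ c * φ p ∧ cappedDensity κ φ c p ≤ φ p := by
  have h : φ p * (max 1 (marginalDensity κ φ (p.1, p.2.1)))⁻¹ ≤ φ p :=
    mul_le_of_le_one_right' (ENNReal.inv_le_one.2 (le_max_left _ _))
  refine ⟨?_, ?_⟩
  · unfold cappedDensity
    gcongr
  · exact (mul_le_of_le_one_left' hc).trans h

lemma cappedMarginal_le_one (hc : c ≤ 1) (p : A × X) : cappedMarginal κ φ c p ≤ 1 := by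
  refine (mul_le_of_le_one_left' hc).trans ?_
  rw [← div_eq_mul_inv]
  exact ENNReal.div_le_of_le_mul (by rw [one_mul]; exact le_max_right _ _)

variable [MeasurableSpace A]

lemma measurable_marginalDensity [IsSFiniteKernel κ] (hφ : Measurable φ) :
    Measurable (marginalDensity κ φ) :=
  Measurable.lintegral_kernel_prod_right (κ := κ.comap Prod.snd measurable_snd)
    (f := fun (p : A × X) t => φ (p.1, (p.2, t))) (by fun_prop)

lemma measurable_cappedDensity [IsSFiniteKernel κ] (hφ : Measurable φ) :
    Measurable (cappedDensity κ φ c) := by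
  have := measurable_marginalDensity (κ := κ) hφ
  unfold cappedDensity
  fun_prop

lemma measurable_cappedMarginal [IsSFiniteKernel κ] (hφ : Measurable φ) :
    Measurable (cappedMarginal κ φ c) := by
  have := measurable_marginalDensity (κ := κ) hφ
  unfold cappedMarginal
  fun_prop

lemma lintegral_cappedDensity_fibre (hφ : Measurable φ) (a : A) (x : X) :
    ∫⁻ t, cappedDensity κ φ c (a, (x, t)) ∂(κ x) = cappedMarginal κ φ c (a, x) := by
  unfold cappedDensity cappedMarginal
  dsimp only
  rw [lintegral_const_mul _ (by fun_prop), lintegral_mul_const _ (by fun_prop)]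
  rfl

lemma map_fst_withDensity_cappedDensity [IsProbabilityMeasure D] [IsMarkovKernel κ]
    (hφ : Measurable φ) (a : A) :
    ((D ⊗ₘ κ).withDensity (fun y => cappedDensity κ φ c (a, y))).map Prod.fst
      = D.withDensity (fun x => cappedMarginal κ φ c (a, x)) := by
  have hm := measurable_cappedDensity (κ := κ) (c := c) hφ
  refine Measure.ext fun s hs => ?_
  rw [Measure.map_apply measurable_fst hs, withDensity_apply _ (measurable_fst hs),
    withDensity_apply _ hs, ← Set.prod_univ,
    Measure.setLIntegral_compProd (by fun_prop) hs MeasurableSet.univ]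
  simp only [Measure.restrict_univ, lintegral_cappedDensity_fibre hφ]

variable (κ φ c) in
/-- The repaired conditional laws of a pair: the capped law, completed by clean pairs `(x, x)`. -/
def repairedKernel (hφ : Measurable φ) [IsProbabilityMeasure D] [IsMarkovKernel κ] :
    Kernel A (X × X) where
  toFun a := (D ⊗ₘ κ).withDensity (fun y => cappedDensity κ φ c (a, y))
    + (D.withDensity (fun x => 1 - cappedMarginal κ φ c (a, x))).map (fun x => (x, x))
  measurable' := by
    have hm := measurable_cappedDensity (κ := κ) (c := c) hφ
    have hm' := measurable_cappedMarginal (κ := κ) (c := c) hφ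
    refine Measure.measurable_of_measurable_coe _ fun s hs => ?_
    have hdiag : Measurable (fun x : X => (x, x)) := by fun_prop
    simp only [Measure.add_apply, Measure.map_apply hdiag hs, withDensity_apply _ hs,
      withDensity_apply _ (hdiag hs)]
    refine Measurable.add ?_ ?_
    · exact Measurable.lintegral_prod_right' (f := fun p : A × (X × X) => cappedDensity κ φ c p) hm
    · exact Measurable.lintegral_prod_right' (f := fun p : A × X => 1 - cappedMarginal κ φ c p)
        (measurable_const.sub hm')

variable [IsProbabilityMeasure D] [IsMarkovKernel κ]

lemma repairedKernel_apply (hφ : Measurable φ) (a : A) : repairedKernel D κ φ c hφ a =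
    (D ⊗ₘ κ).withDensity (fun y => cappedDensity κ φ c (a, y))
    + (D.withDensity (fun x => 1 - cappedMarginal κ φ c (a, x))).map (fun x => (x, x)) := rfl

lemma map_fst_repairedKernel (hφ : Measurable φ) (hc : c ≤ 1) (a : A) :
    (repairedKernel D κ φ c hφ a).map Prod.fst = D := by
  have hm' := measurable_cappedMarginal (κ := κ) (c := c) hφ
  rw [repairedKernel_apply, Measure.map_add _ _ measurable_fst,
    map_fst_withDensity_cappedDensity D hφ, Measure.map_map measurable_fst (by fun_prop)]
  have : (Prod.fst ∘ fun x : X => (x, x)) = id := rfl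
  rw [this, Measure.map_id, ← withDensity_add_left (by fun_prop)]
  conv_rhs => rw [← withDensity_one (μ := D)]
  congr 1
  ext x
  exact add_tsub_cancel_of_le (cappedMarginal_le_one hc _)

lemma isMarkovKernel_repairedKernel (hφ : Measurable φ) (hc : c ≤ 1) :
    IsMarkovKernel (repairedKernel D κ φ c hφ) := by
  refine ⟨fun a => ⟨?_⟩⟩
  have h := congrArg (fun μ : Measure X => μ Set.univ) (map_fst_repairedKernel D (κ := κ) hφ hc a)
  simpa [Measure.map_apply measurable_fst MeasurableSet.univ] using h

/-- The added pairs `(x, x)` cost nothing and the capped density is at most `c * φ`. The factor `c`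
is what compensates for a conditional cost slightly above 1. -/
lemma lintegral_repairedKernel_le (hφ : Measurable φ) (hc : c ≤ 1) {ρ : X → X → ℝ≥0∞}
    (hρ : IsCostFunction ρ) (hρm : Measurable (fun p : X × X => ρ p.1 p.2)) (a : A) :
    ∫⁻ y, ρ y.1 y.2 ∂(repairedKernel D κ φ c hφ a)
      ≤ c * ∫⁻ y, φ (a, y) * ρ y.1 y.2 ∂(D ⊗ₘ κ) := by
  have hm := measurable_cappedDensity (κ := κ) (c := c) hφ
  rw [repairedKernel_apply, lintegral_add_measure, lintegral_map hρm (by fun_prop)]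
  simp only [hρ _, lintegral_zero, add_zero]
  rw [lintegral_withDensity_eq_lintegral_mul _ (by fun_prop) hρm,
    ← lintegral_const_mul _ (by fun_prop)]
  refine lintegral_mono fun y => ?_
  simp only [Pi.mul_apply]
  rw [← mul_assoc]
  gcongr
  exact (cappedDensity_le hc _).1

/-- If `q` is the marginal density, the capped marginal is `c * min 1 q`, and its deficit from 1 is
at most `(1 - c) + (1 - q)` with truncated subtraction. -/
lemma one_sub_lintegral_cappedDensity_le (hφ : Measurable φ) {a : A}
    (h1 : ∫⁻ y, φ (a, y) ∂(D ⊗ₘ κ) = 1) :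
    1 - ∫⁻ y, cappedDensity κ φ c (a, y) ∂(D ⊗ₘ κ)
      ≤ (1 - c) + ∫⁻ x, (1 - marginalDensity κ φ (a, x)) ∂D := by
  have hm := measurable_cappedDensity (κ := κ) (c := c) hφ
  have hm' := measurable_cappedMarginal (κ := κ) (c := c) hφ
  have hq := measurable_marginalDensity (κ := κ) hφ
  have hqi : ∫⁻ x, marginalDensity κ φ (a, x) ∂D = 1 := by
    rw [← h1, Measure.lintegral_compProd (by fun_prop)]
    rfl
  have hfin : ∀ᵐ x ∂D, marginalDensity κ φ (a, x) < ∞ :=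
    ae_lt_top (by fun_prop) (by rw [hqi]; exact ENNReal.one_ne_top)
  rw [Measure.lintegral_compProd (by fun_prop)]
  simp only [lintegral_cappedDensity_fibre hφ]
  rw [tsub_le_iff_right]
  calc (1 : ℝ≥0∞) = ∫⁻ _, 1 ∂D := by simp
    _ ≤ ∫⁻ x, ((1 - c) + (1 - marginalDensity κ φ (a, x)) + cappedMarginal κ φ c (a, x)) ∂D := by
        refine lintegral_mono_ae ?_
        filter_upwards [hfin] with x hx
        unfold cappedMarginal
        rcases le_total (marginalDensity κ φ (a, x)) 1 with h | h
        · rw [max_eq_left h, inv_one, mul_one]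
          set q := marginalDensity κ φ (a, x)
          calc (1 : ℝ≥0∞) = (1 - q) + q := (tsub_add_cancel_of_le h).symm
            _ ≤ (1 - q) + ((1 - c) + c) * q := by
                gcongr
                exact le_mul_of_one_le_left' le_tsub_add
            _ ≤ (1 - c) + (1 - q) + c * q := by
                rw [add_mul, add_comm (1 - c), add_assoc]
                gcongr
                exact mul_le_of_le_one_right' h
        · rw [max_eq_right h, ENNReal.mul_inv_cancel (by positivity) hx.ne, mul_one,
            add_right_comm]
          exact le_tsub_add.trans le_self_add
    _ = _ := by
        rw [lintegral_add_left (by fun_prop), lintegral_add_left (by fun_prop)]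
        simp

end Repair

/-- The mixture draws `a` from `M₀` and takes the `n`-fold product of the second marginal of the
repaired law. The capped law lies below both the original and the repaired one, so a test loses at
most the mass removed by capping, and Bernoulli's inequality bounds this by `n` times the one-pair
loss. -/
lemma exists_oblivious_mixture {A X : Type*} [MeasurableSpace A] [StandardBorelSpace A]
    [MeasurableSpace X] [StandardBorelSpace X] (M₀ : Measure A) [IsProbabilityMeasure M₀]
    (D : Measure X) [IsProbabilityMeasure D] (κ : Kernel X X) [IsMarkovKernel κ]
    {φ : A × (X × X) → ℝ≥0∞} (hφ : Measurable φ)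
    (h1 : ∀ᵐ a ∂M₀, ∫⁻ y, φ (a, y) ∂(D ⊗ₘ κ) = 1) {c : ℝ≥0∞} (hc : c ≤ 1)
    {ρ : X → X → ℝ≥0∞} (hρ : IsCostFunction ρ) (hρm : Measurable (fun p : X × X => ρ p.1 p.2))
    (hcost : ∀ᵐ a ∂M₀, c * ∫⁻ y, φ (a, y) * ρ y.1 y.2 ∂(D ⊗ₘ κ) ≤ 1) (n : ℕ) :
    ∃ Q : Measure (Measure (Fin n → X)), IsProbabilityMeasure Q ∧
      (∀ᵐ E ∂Q, E ∈ obliviousCorruptions n ρ D) ∧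
      ∀ T : (Fin n → X) → ℝ≥0∞, Measurable T → (∀ x, T x ≤ 1) →
        ∫⁻ p, T (fun i => (p.2 i).2) ∂((M₀.prod (Measure.pi fun _ : Fin n => D ⊗ₘ κ)).withDensity
            (fun p => ∏ i, φ (p.1, p.2 i)))
          ≤ ∫⁻ x, T x ∂Q.join
            + n * ((1 - c) + ∫⁻ p, (1 - marginalDensity κ φ p) ∂(M₀.prod D)) := by
  set u := D ⊗ₘ κ with hu
  set R := repairedKernel D κ φ c hφ with hR
  have hRm : IsMarkovKernel R := isMarkovKernel_repairedKernel D hφ hc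
  have hRs : IsMarkovKernel (R.map Prod.snd) := Kernel.IsMarkovKernel.map R measurable_snd
  set f := piKernel (fun _ : Fin n => R.map Prod.snd) with hf
  have hψm := measurable_cappedDensity (κ := κ) (c := c) hφ
  have hqm := measurable_marginalDensity (κ := κ) hφ
  refine ⟨M₀.map f, Measure.isProbabilityMeasure_map f.measurable.aemeasurable, ?_, ?_⟩
  · refine ae_map_measure_of_ae M₀ f.measurable (fun a => inferInstance) ?_
    filter_upwards [hcost] with a ha
    refine ⟨(R a).map Prod.snd, ⟨R a, ⟨map_fst_repairedKernel D hφ hc a, rfl⟩, ?_⟩, ?_⟩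
    · exact (lintegral_repairedKernel_le D hφ hc hρ hρm a).trans ha
    · rw [hf, piKernel_apply]
      simp only [Kernel.map_apply _ measurable_snd]
  · intro T hT hT1
    set ν := M₀.prod (Measure.pi fun _ : Fin n => u) with hν
    set Φ : A × (Fin n → X × X) → ℝ≥0∞ := fun p => ∏ i, φ (p.1, p.2 i) with hΦ
    set Ψ : A × (Fin n → X × X) → ℝ≥0∞ := fun p => ∏ i, cappedDensity κ φ c (p.1, p.2 i) with hΨ
    have hΦm : Measurable Φ := by fun_prop
    have hΨm : Measurable Ψ := by fun_prop
    have hTm : Measurable (fun p : A × (Fin n → X × X) => T (fun i => (p.2 i).2)) := by fun_prop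
    have hle : ∀ p, Ψ p ≤ Φ p := fun p =>
      Finset.prod_le_prod' fun i _ => (cappedDensity_le hc _).2
    have hΦ1 : ∫⁻ p, Φ p ∂ν = 1 := by
      rw [hΦ, hν, lintegral_prod_pi_density M₀ u hφ]
      calc _ = ∫⁻ _, 1 ∂M₀ := by
            refine lintegral_congr_ae ?_
            filter_upwards [h1] with a ha
            rw [ha, one_pow]
        _ = 1 := by simp
    have hΨ1 : ∫⁻ p, Ψ p ∂ν ≠ ∞ :=
      ne_top_of_le_ne_top (by rw [hΦ1]; exact ENNReal.one_ne_top) (lintegral_mono hle)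
    -- The capped law is a submeasure of the repaired one, and this order survives products.
    have hmain : ∫⁻ p, T (fun i => (p.2 i).2) * Ψ p ∂ν ≤ ∫⁻ x, T x ∂(M₀.map f).join := by
      rw [Measure.lintegral_join hT.aemeasurable, lintegral_map (Measure.measurable_lintegral hT) f.measurable,
        hν, lintegral_prod _ (by fun_prop)]
      refine lintegral_mono fun a => ?_
      set V := u.withDensity (fun y => cappedDensity κ φ c (a, y)) with hV
      have hVR : V ≤ R a := by
        rw [hR, repairedKernel_apply]
        exact Measure.le_add_right le_rfl
      have hVf : IsFiniteMeasure V := isFiniteMeasure_of_le _ hVR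
      have hpi : Measure.pi (fun _ : Fin n => V) ≤ Measure.pi (fun _ : Fin n => R a) :=
        pi_mono_measure hVR
      have hfa : f a = (Measure.pi (fun _ : Fin n => R a)).map (fun w i => (w i).2) := by
        rw [hf, piKernel_apply]
        simp only [Kernel.map_apply _ measurable_snd]
        have : ∀ _ : Fin n, SigmaFinite ((R a).map Prod.snd) := fun _ => by
          rw [← Kernel.map_apply _ measurable_snd]; infer_instance
        exact (Measure.pi_map_pi (μ := fun _ : Fin n => R a) (f := fun _ => Prod.snd)
          fun _ => measurable_snd.aemeasurable).symm
      rw [hfa, lintegral_map hT (by fun_prop)]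
      refine le_trans (le_of_eq ?_) (lintegral_mono' hpi le_rfl)
      rw [hV, pi_withDensity u (by fun_prop),
        lintegral_withDensity_eq_lintegral_mul _ (by fun_prop) (by fun_prop)]
      simp only [Pi.mul_apply, hΨ, mul_comm]
    have hloss : 1 - ∫⁻ p, Ψ p ∂ν
        ≤ n * ((1 - c) + ∫⁻ p, (1 - marginalDensity κ φ p) ∂(M₀.prod D)) := by
      have hwm : Measurable (fun a => ∫⁻ y, cappedDensity κ φ c (a, y) ∂u) :=
        Measurable.lintegral_prod_right' (f := fun p => cappedDensity κ φ c p) hψm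
      rw [tsub_le_iff_left, hΨ, hν, lintegral_prod_pi_density M₀ u hψm, Fintype.card_fin]
      calc (1 : ℝ≥0∞) = ∫⁻ _, 1 ∂M₀ := by simp
        _ ≤ ∫⁻ a, ((∫⁻ y, cappedDensity κ φ c (a, y) ∂u) ^ n
              + n * ((1 - c) + ∫⁻ x, (1 - marginalDensity κ φ (a, x)) ∂D)) ∂M₀ := by
            refine lintegral_mono_ae ?_
            filter_upwards [h1] with a ha
            have hw : ∫⁻ y, cappedDensity κ φ c (a, y) ∂u ≤ 1 := by
              rw [← ha]
              exact lintegral_mono fun y => (cappedDensity_le hc _).2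
            refine (one_le_pow_add_mul_one_sub hw n).trans ?_
            gcongr
            exact one_sub_lintegral_cappedDensity_le D hφ ha
        _ = _ := by
            have hm1 : Measurable fun p : A × X => 1 - marginalDensity κ φ p :=
              measurable_const.sub hqm
            have hm2 : Measurable fun a => ∫⁻ x, (1 - marginalDensity κ φ (a, x)) ∂D :=
              hm1.lintegral_prod_right'
            rw [lintegral_add_left (hwm.pow_const n),
              lintegral_const_mul _ (by fun_prop), lintegral_add_left measurable_const,
              lintegral_prod _ hm1.aemeasurable]
            simp
    calc _ = ∫⁻ p, Φ p * T (fun i => (p.2 i).2) ∂ν :=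
          lintegral_withDensity_eq_lintegral_mul _ hΦm hTm
      _ ≤ ∫⁻ p, (T (fun i => (p.2 i).2) * Ψ p + (Φ p - Ψ p)) ∂ν := by
          refine lintegral_mono fun p => ?_
          dsimp only
          calc Φ p * T (fun i => (p.2 i).2) = (Ψ p + (Φ p - Ψ p)) * T (fun i => (p.2 i).2) := by
                rw [add_tsub_cancel_of_le (hle p)]
            _ ≤ _ := by
                rw [add_mul, mul_comm (Ψ p)]
                gcongr
                exact mul_le_of_le_one_right' (hT1 _)
      _ = ∫⁻ p, T (fun i => (p.2 i).2) * Ψ p ∂ν + (1 - ∫⁻ p, Ψ p ∂ν) := by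
          rw [lintegral_add_left (by fun_prop), lintegral_sub hΨm hΨ1 (ae_of_all _ hle), hΦ1]
      _ ≤ _ := add_le_add hmain hloss

lemma map_withDensity_marginalDensity {A X : Type*} [MeasurableSpace A] [MeasurableSpace X]
    (M₀ : Measure A) [IsProbabilityMeasure M₀] (D : Measure X) [IsProbabilityMeasure D]
    (κ : Kernel X X) [IsMarkovKernel κ] {φ : A × (X × X) → ℝ≥0∞} (hφ : Measurable φ) :
    ((M₀.prod (D ⊗ₘ κ)).withDensity φ).map (fun p => (p.1, p.2.1))
      = (M₀.prod D).withDensity (marginalDensity κ φ) := by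
  have hqm := measurable_marginalDensity (κ := κ) hφ
  have hg : Measurable (fun p : A × (X × X) => (p.1, p.2.1)) := by fun_prop
  refine Measure.ext fun s hs => ?_
  have e : ∀ (a : A) (y : X × X), ((fun p : A × (X × X) => (p.1, p.2.1)) ⁻¹' s).indicator φ (a, y)
      = s.indicator (fun _ => φ (a, y)) (a, y.1) := fun a y => by
    by_cases h : (a, y.1) ∈ s <;> simp [Set.indicator, h]
  rw [Measure.map_apply hg hs, withDensity_apply _ (hg hs), withDensity_apply _ hs,
    ← lintegral_indicator (hg hs), ← lintegral_indicator hs,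
    lintegral_prod _ (hφ.indicator (hg hs)).aemeasurable,
    lintegral_prod _ (hqm.indicator hs).aemeasurable]
  refine lintegral_congr fun a => ?_
  rw [Measure.lintegral_compProd
    (f := fun y => ((fun p : A × (X × X) => (p.1, p.2.1)) ⁻¹' s).indicator φ (a, y))
    ((hφ.indicator (hg hs)).comp measurable_prodMk_left)]
  refine lintegral_congr fun x => ?_
  simp only [e]
  by_cases h : (a, x) ∈ s
  · simp only [Set.indicator, h, if_true]; rfl
  · simp [Set.indicator, h]

/-- The truncated difference is at most `|q - 1|`, so the Pinsker-type bound applies. -/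
lemma lintegral_one_sub_density_le {Ω : Type*} [MeasurableSpace Ω] (ν : Measure Ω)
    [IsProbabilityMeasure ν] {q : Ω → ℝ≥0∞} (hq : Measurable q)
    [IsProbabilityMeasure (ν.withDensity q)] {t : ℝ} (ht : 0 < t) :
    ∫⁻ x, (1 - q x) ∂ν
      ≤ klDiv (ν.withDensity q) ν * ENNReal.ofReal t⁻¹ + ENNReal.ofReal t := by
  refine le_trans (lintegral_mono_ae ?_) (lintegral_dist_one_rnDeriv_le (ν.withDensity q) ν
    (withDensity_absolutelyContinuous _ _) ht)
  filter_upwards [Measure.rnDeriv_withDensity ν hq, Measure.rnDeriv_lt_top (ν.withDensity q) ν]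
    with x hx hlt
  rw [hx] at hlt ⊢
  conv_lhs => rw [← ENNReal.ofReal_toReal hlt.ne, ← ENNReal.ofReal_one,
    ← ENNReal.ofReal_sub _ ENNReal.toReal_nonneg]
  exact ENNReal.ofReal_le_ofReal (by rw [abs_sub_comm]; exact le_abs_self _)

/-! ### Exchangeable sequences -/

/-- The first `m` terms of a random sequence with law `μ` are exchangeable. -/
def IsExchangeableBelow {Y : Type*} [MeasurableSpace Y] (m : ℕ) (μ : Measure (ℕ → Y)) : Prop :=
  ∀ (k : ℕ) (e : Fin k → ℕ), Function.Injective e → (∀ i, e i < m) →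
    μ.map (fun z i => z (e i)) = μ.map (fun z (i : Fin k) => z i)

section Sequence

variable {Y B : Type*} [MeasurableSpace Y] [MeasurableSpace B]

/-- The law of the first `k` terms. -/
def initialLaw (μ : Measure (ℕ → Y)) (k : ℕ) : Measure (Fin k → Y) :=
  μ.map (fun z i => z i)

/-- The joint law of the first `k` terms and the images under `g` of the next `l` terms. -/
def blockLaw (g : Y → B) (μ : Measure (ℕ → Y)) (k l : ℕ) :
    Measure ((Fin k → Y) × (Fin l → B)) :=
  μ.map (fun z => (fun i => z i, fun j => g (z (k + j))))

/-- The joint law of the first `k` terms and the image under `g` of the next term. -/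
def pointLaw (g : Y → B) (μ : Measure (ℕ → Y)) (k : ℕ) : Measure ((Fin k → Y) × B) :=
  μ.map (fun z => (fun i => z i, g (z k)))

variable {g : Y → B} {μ : Measure (ℕ → Y)} {m k l : ℕ}

instance [IsProbabilityMeasure μ] : IsProbabilityMeasure (initialLaw μ k) :=
  Measure.isProbabilityMeasure_map
    (by fun_prop : Measurable fun (z : ℕ → Y) (i : Fin k) => z i).aemeasurable

lemma isProbabilityMeasure_blockLaw [IsProbabilityMeasure μ] (hg : Measurable g) :
    IsProbabilityMeasure (blockLaw g μ k l) :=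
  Measure.isProbabilityMeasure_map (by fun_prop)

lemma isProbabilityMeasure_pointLaw [IsProbabilityMeasure μ] (hg : Measurable g) :
    IsProbabilityMeasure (pointLaw g μ k) :=
  Measure.isProbabilityMeasure_map (by fun_prop)

lemma map_fst_blockLaw (hg : Measurable g) :
    (blockLaw g μ k l).map Prod.fst = initialLaw μ k := by
  rw [blockLaw, Measure.map_map measurable_fst (by fun_prop)]; rfl

lemma map_fst_pointLaw (hg : Measurable g) :
    (pointLaw g μ k).map Prod.fst = initialLaw μ k := by
  rw [pointLaw, Measure.map_map measurable_fst (by fun_prop)]; rfl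

lemma IsExchangeableBelow.map_pair (h : IsExchangeableBelow m μ) (hg : Measurable g) {i : ℕ}
    (hki : k ≤ i) (him : i < m) :
    μ.map (fun z => (fun i : Fin k => z i, g (z i))) = pointLaw g μ k := by
  -- The injection `0, …, k - 1, i`.
  set e : Fin (k + 1) → ℕ := Fin.snoc (α := fun _ => ℕ) (fun j : Fin k => (j : ℕ)) i with he
  have hinj : Function.Injective e := by
    refine Fin.lastCases ?_ ?_
    · refine Fin.lastCases (fun _ => rfl) fun j hj => ?_
      simp only [he, Fin.snoc_last, Fin.snoc_castSucc] at hj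
      omega
    · intro j
      refine Fin.lastCases (fun hj => ?_) fun j' hj => ?_
      · simp only [he, Fin.snoc_last, Fin.snoc_castSucc] at hj
        omega
      · simp only [he, Fin.snoc_castSucc] at hj
        rw [Fin.ext hj]
  have hlt : ∀ j, e j < m := by
    refine Fin.lastCases ?_ fun j => ?_
    · simpa [he] using him
    · simp only [he, Fin.snoc_castSucc]; omega
  have hf : Measurable (fun w : Fin (k + 1) → Y =>
    ((fun j : Fin k => w j.castSucc), g (w (Fin.last k)))) := by fun_prop
  have := congrArg (Measure.map (fun w : Fin (k + 1) → Y =>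
    ((fun j : Fin k => w j.castSucc), g (w (Fin.last k))))) (h (k + 1) e hinj hlt)
  rw [Measure.map_map hf (by fun_prop), Measure.map_map hf (by fun_prop)] at this
  simpa [Function.comp_def, he, pointLaw] using this

lemma IsExchangeableBelow.map_blockLaw_eval (h : IsExchangeableBelow m μ) (hg : Measurable g)
    (hkl : k + l ≤ m) (j : Fin l) :
    (blockLaw g μ k l).map (fun p => (p.1, p.2 j)) = pointLaw g μ k := by
  rw [blockLaw, Measure.map_map (by fun_prop) (by fun_prop)]
  exact h.map_pair hg (i := k + j) (by omega) (by omega)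

/-- Splitting off the first `k` entries of a tuple. -/
def splitEquiv (Y : Type*) [MeasurableSpace Y] (k l : ℕ) :
    (Fin (k + l) → Y) ≃ᵐ (Fin k → Y) × (Fin l → Y) where
  toFun w := (fun i => w (Fin.castAdd l i), fun j => w (Fin.natAdd k j))
  invFun p := Fin.append p.1 p.2
  left_inv w := by
    ext i
    refine Fin.addCases (fun i => ?_) (fun j => ?_) i <;> simp
  right_inv p := by ext i <;> simp
  measurable_toFun := by
    simp only [Equiv.coe_fn_mk]
    fun_prop
  measurable_invFun := by
    simp only [Equiv.coe_fn_symm_mk]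
    refine measurable_pi_iff.2 fun i => ?_
    refine Fin.addCases (fun i => ?_) (fun j => ?_) i
    · simp only [Fin.append_left]; fun_prop
    · simp only [Fin.append_right]; fun_prop

lemma map_splitEquiv_pi (u : Measure Y) [IsProbabilityMeasure u] :
    (Measure.pi fun _ : Fin (k + l) => u).map (splitEquiv Y k l)
      = (Measure.pi fun _ : Fin k => u).prod (Measure.pi fun _ : Fin l => u) := by
  have h : Measure.pi (fun _ : Fin (k + l) => u)
      = ((Measure.pi fun _ : Fin k => u).prod (Measure.pi fun _ : Fin l => u)).map
        (splitEquiv Y k l).symm := by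
    refine Measure.pi_eq fun s hs => ?_
    rw [MeasurableEquiv.map_apply]
    have : (splitEquiv Y k l).symm ⁻¹' Set.univ.pi s
        = (Set.univ.pi fun i => s (Fin.castAdd l i)) ×ˢ (Set.univ.pi fun j => s (Fin.natAdd k j)) := by
      ext p
      simp only [Set.mem_preimage, Set.mem_pi, Set.mem_univ, true_imp_iff, Set.mem_prod]
      have e : ∀ i, (splitEquiv Y k l).symm p i = Fin.append p.1 p.2 i := fun _ => rfl
      simp only [e]
      constructor
      · intro h
        exact ⟨fun i => by simpa using h (Fin.castAdd l i), fun j => by simpa using h (Fin.natAdd k j)⟩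
      · rintro ⟨h1, h2⟩ i
        refine Fin.addCases (fun i => ?_) (fun j => ?_) i
        · simpa using h1 i
        · simpa using h2 j
    rw [this, Measure.prod_prod, Measure.pi_pi, Measure.pi_pi, Fin.prod_univ_add]
  rw [h, MeasurableEquiv.map_map_symm]

lemma klDiv_blockLaw_id [IsProbabilityMeasure μ] (u : Measure Y) [IsProbabilityMeasure u] :
    klDiv (blockLaw id μ k l) ((Measure.pi fun _ : Fin k => u).prod (Measure.pi fun _ : Fin l => u))
      = klDiv (initialLaw μ (k + l)) (Measure.pi fun _ => u) := by
  rw [← klDiv_map_measurableEquiv (initialLaw μ (k + l)) _ (splitEquiv Y k l), map_splitEquiv_pi u,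
    initialLaw, Measure.map_map (splitEquiv Y k l).measurable (by fun_prop)]
  rfl

lemma klDiv_pointLaw_id [IsProbabilityMeasure μ] (u : Measure Y) [IsProbabilityMeasure u] :
    klDiv (pointLaw id μ k) ((Measure.pi fun _ : Fin k => u).prod u)
      = klDiv (initialLaw μ (k + 1)) (Measure.pi fun _ => u) := by
  have : IsProbabilityMeasure (blockLaw (id : Y → Y) μ k 1) :=
    isProbabilityMeasure_blockLaw measurable_id
  rw [← klDiv_blockLaw_id (k := k) (l := 1) u]
  set e : (Fin k → Y) × (Fin 1 → Y) ≃ᵐ (Fin k → Y) × Y :=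
    (MeasurableEquiv.refl _).prodCongr (MeasurableEquiv.funUnique (Fin 1) Y) with he
  rw [← klDiv_map_measurableEquiv _ _ e]
  have h1 : ⇑e = fun p => (p.1, p.2 0) := rfl
  rw [h1, map_prod_eval, blockLaw, Measure.map_map (by fun_prop) (by fun_prop)]
  rfl

lemma klDiv_blockLaw_chain [StandardBorelSpace B] [Nonempty B] [IsProbabilityMeasure μ]
    (hg : Measurable g) (u : Measure Y) [IsProbabilityMeasure u] (β : Measure B) [IsProbabilityMeasure β] :
    klDiv (blockLaw g μ k l) ((Measure.pi fun _ : Fin k => u).prod (Measure.pi fun _ : Fin l => β))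
      = klDiv (initialLaw μ k) (Measure.pi fun _ => u)
        + klDiv (blockLaw g μ k l) ((initialLaw μ k).prod (Measure.pi fun _ : Fin l => β)) := by
  have := isProbabilityMeasure_blockLaw (μ := μ) (k := k) (l := l) hg
  rw [klDiv_prod_eq_add, map_fst_blockLaw hg]

/-- This identifies the increments of `A k` with the divergence of one term given the preceding `k`.
-/
lemma klDiv_pointLaw_eq_add [StandardBorelSpace Y] [Nonempty Y] [IsProbabilityMeasure μ] (u : Measure Y) [IsProbabilityMeasure u] :
    klDiv (initialLaw μ (k + 1)) (Measure.pi fun _ => u)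
      = klDiv (initialLaw μ k) (Measure.pi fun _ => u)
        + klDiv (pointLaw id μ k) ((initialLaw μ k).prod u) := by
  have := isProbabilityMeasure_pointLaw (μ := μ) (k := k) (g := (id : Y → Y)) measurable_id
  rw [← klDiv_pointLaw_id, klDiv_prod_eq_add, map_fst_pointLaw measurable_id]

lemma klDiv_initialLaw_add [StandardBorelSpace Y] [Nonempty Y] [IsProbabilityMeasure μ] (u : Measure Y) [IsProbabilityMeasure u] :
    klDiv (initialLaw μ (k + l)) (Measure.pi fun _ => u)
      = klDiv (initialLaw μ k) (Measure.pi fun _ => u)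
        + klDiv (blockLaw id μ k l) ((initialLaw μ k).prod (Measure.pi fun _ : Fin l => u)) := by
  rw [← klDiv_blockLaw_id, klDiv_blockLaw_chain measurable_id]

/-- The compensation identity for a block of an exchangeable sequence. -/
lemma IsExchangeableBelow.klDiv_blockLaw_eq_add [IsProbabilityMeasure μ]
    (h : IsExchangeableBelow m μ) (hg : Measurable g) (hkl : k + l ≤ m) (β : Measure B)
    [IsProbabilityMeasure β] {φ : (Fin k → Y) × B → ℝ≥0∞} (hφ : Measurable φ)
    (h1 : ∀ᵐ a ∂(initialLaw μ k), ∫⁻ b, φ (a, b) ∂β = 1)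
    (hpt : pointLaw g μ k = ((initialLaw μ k).prod β).withDensity φ)
    (hfin : klDiv (blockLaw g μ k l) ((initialLaw μ k).prod (Measure.pi fun _ => β)) ≠ ∞) :
    klDiv (blockLaw g μ k l) (((initialLaw μ k).prod (Measure.pi fun _ => β)).withDensity
        (fun p => ∏ i, φ (p.1, p.2 i)))
      + l * klDiv (pointLaw g μ k) ((initialLaw μ k).prod β)
      = klDiv (blockLaw g μ k l) ((initialLaw μ k).prod (Measure.pi fun _ => β)) := by
  have := isProbabilityMeasure_blockLaw (μ := μ) (k := k) (l := l) hg
  have h2 := klDiv_prod_pi_eq_add (initialLaw μ k) β (blockLaw g μ k l) hφ h1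
    (fun j => by rw [h.map_blockLaw_eval hg hkl j, hpt]) hfin
  rw [← h2, hpt]
  simp

/-- Superadditivity of the divergence along an exchangeable sequence. -/
lemma IsExchangeableBelow.mul_klDiv_pointLaw_le [StandardBorelSpace Y] [Nonempty Y]
    [IsProbabilityMeasure μ]
    (h : IsExchangeableBelow m μ) (u : Measure Y) [IsProbabilityMeasure u] (hkl : k + l ≤ m)
    (hk : k < m) (hfin : ∀ j ≤ m, klDiv (initialLaw μ j) (Measure.pi fun _ => u) ≠ ∞) :
    klDiv (initialLaw μ k) (Measure.pi fun _ => u)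
        + l * klDiv (pointLaw id μ k) ((initialLaw μ k).prod u)
      ≤ klDiv (initialLaw μ (k + l)) (Measure.pi fun _ => u) := by
  have := isProbabilityMeasure_pointLaw (μ := μ) (k := k) (g := (id : Y → Y)) measurable_id
  have hfin1 : klDiv (pointLaw id μ k) ((initialLaw μ k).prod u) ≠ ∞ := by
    refine ne_top_of_le_ne_top (hfin (k + 1) hk) ?_
    rw [klDiv_pointLaw_eq_add]; exact le_add_self
  obtain ⟨φ, hφ, hd, h1⟩ := exists_density_of_klDiv_ne_top (pointLaw id μ k) u
    (by rwa [map_fst_pointLaw measurable_id])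
  rw [map_fst_pointLaw measurable_id] at hd h1
  rw [klDiv_initialLaw_add]
  gcongr
  -- The discarded summand is the divergence from the mixture of products, which is nonnegative.
  rw [← h.klDiv_blockLaw_eq_add measurable_id hkl u hφ h1 hd]
  · exact le_add_self
  · refine ne_top_of_le_ne_top (hfin (k + l) hkl) ?_
    rw [klDiv_initialLaw_add]; exact le_add_self

end Sequence

/-! ### Conditioning on the first `k` pairs -/

section Core

variable {X : Type*} [MeasurableSpace X] {D : Measure X}
  [IsProbabilityMeasure D] {κ : Kernel X X} [IsMarkovKernel κ] {ρ : X → X → ℝ≥0∞}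
  {μ : Measure (ℕ → X × X)} [IsProbabilityMeasure μ] {m n k d : ℕ}

/-- By exchangeability, the conditional expected cost of a pair given the first `k` pairs is at
most `m / (m - k)`. -/
lemma IsExchangeableBelow.lintegral_cost_le (h : IsExchangeableBelow m μ)
    (hρm : Measurable (fun p : X × X => ρ p.1 p.2))
    (hcost : ∀ᵐ z ∂μ, ∑ i ∈ Finset.range m, ρ (z i).1 (z i).2 ≤ m) (hk : k < m)
    {u : Measure (X × X)} [IsProbabilityMeasure u] {φ : (Fin k → X × X) × (X × X) → ℝ≥0∞}
    (hφ : Measurable φ) (hpt : pointLaw id μ k = ((initialLaw μ k).prod u).withDensity φ) :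
    ∀ᵐ a ∂(initialLaw μ k),
      ((m - k : ℕ) : ℝ≥0∞) / m * ∫⁻ y, φ (a, y) * ρ y.1 y.2 ∂u ≤ 1 := by
  have hJm : Measurable fun p : (Fin k → X × X) × (X × X) => φ p * ρ p.2.1 p.2.2 :=
    hφ.mul (hρm.comp measurable_snd)
  have hJ : Measurable fun a => ∫⁻ y, φ (a, y) * ρ y.1 y.2 ∂u := hJm.lintegral_prod_right'
  have hinit : Measurable fun (z : ℕ → X × X) (i : Fin k) => z i := by fun_prop
  refine ae_le_of_forall_setLIntegral_le_of_sigmaFinite (hJ.const_mul _) fun s hs _ => ?_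
  rw [lintegral_const_mul _ hJ, setLIntegral_one]
  have hF : Measurable fun p : (Fin k → X × X) × (X × X) =>
      s.indicator (fun _ => ρ p.2.1 p.2.2) p.1 := by
    have : (fun p : (Fin k → X × X) × (X × X) => s.indicator (fun _ => ρ p.2.1 p.2.2) p.1)
        = (Prod.fst ⁻¹' s).indicator (fun p => ρ p.2.1 p.2.2) := by
      ext p; by_cases hp : p.1 ∈ s <;> simp [Set.indicator, hp]
    rw [this]
    exact (hρm.comp measurable_snd).indicator (measurable_fst hs)
  have hval : ∫⁻ a in s, ∫⁻ y, φ (a, y) * ρ y.1 y.2 ∂u ∂(initialLaw μ k)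
      = ∫⁻ p, s.indicator (fun _ => ρ p.2.1 p.2.2) p.1 ∂(pointLaw id μ k) := by
    rw [hpt, lintegral_withDensity_eq_lintegral_mul _ hφ hF, lintegral_prod _ (hφ.mul hF).aemeasurable,
      ← lintegral_indicator hs]
    refine lintegral_congr fun a => ?_
    by_cases ha : a ∈ s <;> simp [Set.indicator, ha]
  -- Each of the `m - k` later pairs has the same joint law with the first `k`, and together they
  -- cost at most `m`.
  have hterm : ∀ i ∈ Finset.Ico k m,
      ∫⁻ p, s.indicator (fun _ => ρ p.2.1 p.2.2) p.1 ∂(pointLaw id μ k)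
      = ∫⁻ z, s.indicator (fun _ => ρ (z i).1 (z i).2) (fun j : Fin k => z j) ∂μ := by
    intro i hi
    rw [Finset.mem_Ico] at hi
    rw [← h.map_pair measurable_id hi.1 hi.2, lintegral_map hF (by fun_prop)]
    rfl
  have hsum : ((m - k : ℕ) : ℝ≥0∞)
      * ∫⁻ p, s.indicator (fun _ => ρ p.2.1 p.2.2) p.1 ∂(pointLaw id μ k)
      ≤ m * initialLaw μ k s := by
    calc _ = ∑ i ∈ Finset.Ico k m,
          ∫⁻ z, s.indicator (fun _ => ρ (z i).1 (z i).2) (fun j : Fin k => z j) ∂μ := by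
          rw [← Finset.sum_congr rfl hterm]
          simp
      _ = ∫⁻ z, ∑ i ∈ Finset.Ico k m,
          s.indicator (fun _ => ρ (z i).1 (z i).2) (fun j : Fin k => z j) ∂μ := by
          rw [lintegral_finsetSum]
          intro i _
          exact hF.comp (by fun_prop : Measurable fun z : ℕ → X × X => ((fun j : Fin k => z j), z i))
      _ ≤ ∫⁻ z, s.indicator (fun _ => (m : ℝ≥0∞)) (fun j : Fin k => z j) ∂μ := by
          refine lintegral_mono_ae ?_
          filter_upwards [hcost] with z hz
          by_cases hzs : (fun j : Fin k => z j) ∈ s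
          · simp only [Set.indicator, hzs, if_true]
            refine le_trans (Finset.sum_le_sum_of_subset ?_) hz
            intro i hi
            simp only [Finset.mem_Ico] at hi
            simpa using hi.2
          · simp [Set.indicator, hzs]
      _ = m * initialLaw μ k s := by
          rw [initialLaw, ← lintegral_map (f := s.indicator fun _ => (m : ℝ≥0∞))
            (measurable_const.indicator hs) hinit, lintegral_indicator_const hs]
  have hm0 : (m : ℝ≥0∞) ≠ 0 := by
    have : m ≠ 0 := by omega
    exact_mod_cast this
  rw [hval, ENNReal.div_eq_inv_mul, mul_assoc]
  calc _ ≤ (m : ℝ≥0∞)⁻¹ * (m * initialLaw μ k s) := by gcongr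
    _ = _ := by rw [← mul_assoc, ENNReal.inv_mul_cancel hm0 (ENNReal.natCast_ne_top m), one_mul]

lemma klDiv_blockLaw_fst_le (hd : 1 ≤ d) {l : ℕ}
    (hdom : blockLaw Prod.fst μ k l ≤ (d : ℝ≥0∞) ^ k •
      (Measure.pi fun _ : Fin k => D ⊗ₘ κ).prod (Measure.pi fun _ : Fin l => D)) :
    klDiv (blockLaw Prod.fst μ k l)
        ((Measure.pi fun _ : Fin k => D ⊗ₘ κ).prod (Measure.pi fun _ : Fin l => D))
      ≤ ENNReal.ofReal (k * Real.log d) := by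
  have := isProbabilityMeasure_blockLaw (μ := μ) (k := k) (l := l)
    (measurable_fst (α := X) (β := X))
  have hC : (1 : ℝ) ≤ (d : ℝ) ^ k := one_le_pow₀ (by exact_mod_cast hd)
  refine (klDiv_le_of_le_smul _ _ hC ?_).trans (by rw [Real.log_pow])
  rwa [ENNReal.ofReal_pow (by positivity), ENNReal.ofReal_natCast]

/-- The main construction: after conditioning on the first `k` pairs of an exchangeable corruption,
the next `n` pairs are close to a product of legal corruptions. -/
theorem IsExchangeableBelow.exists_oblivious [StandardBorelSpace X]
    (h : IsExchangeableBelow m μ)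
    (hρ : IsCostFunction ρ) (hρm : Measurable (fun p : X × X => ρ p.1 p.2))
    (hcost : ∀ᵐ z ∂μ, ∑ i ∈ Finset.range m, ρ (z i).1 (z i).2 ≤ m) (hd : 1 ≤ d)
    (hdom : ∀ k l, k + l ≤ m → blockLaw Prod.fst μ k l ≤ (d : ℝ≥0∞) ^ k •
      (Measure.pi fun _ : Fin k => D ⊗ₘ κ).prod (Measure.pi fun _ : Fin l => D))
    (hk : k < m) (hkn : k + n ≤ m)
    (hfin : ∀ j ≤ m, klDiv (initialLaw μ j) (Measure.pi fun _ => D ⊗ₘ κ) ≠ ∞) {τ : ℝ≥0∞}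
    (hτ : klDiv (initialLaw μ (k + n)) (Measure.pi fun _ => D ⊗ₘ κ)
      ≤ klDiv (initialLaw μ k) (Measure.pi fun _ => D ⊗ₘ κ)
        + n * klDiv (pointLaw id μ k) ((initialLaw μ k).prod (D ⊗ₘ κ)) + τ) :
    ∃ Q : Measure (Measure (Fin n → X)), IsProbabilityMeasure Q ∧
      (∀ᵐ E ∂Q, E ∈ obliviousCorruptions n ρ D) ∧
      ∀ T : (Fin n → X) → ℝ≥0∞, Measurable T → (∀ x, T x ≤ 1) → ∀ t t' : ℝ, 0 < t → 0 < t' →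
        ∫⁻ x, T x ∂(μ.map fun z (i : Fin n) => (z i).2)
          ≤ ∫⁻ x, T x ∂Q.join + ((τ * ENNReal.ofReal t⁻¹ + ENNReal.ofReal t)
            + n * ((1 - ((m - k : ℕ) : ℝ≥0∞) / m)
              + (ENNReal.ofReal (k * Real.log d) / ((m - k : ℕ) : ℝ≥0∞) * ENNReal.ofReal t'⁻¹
                + ENNReal.ofReal t'))) := by
  have : Nonempty (X × X) := (nonempty_of_isProbabilityMeasure μ).map fun z => z 0
  have : Nonempty X := this.map Prod.fst
  set u := D ⊗ₘ κ with hu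
  set M₀ := initialLaw μ k with hM₀
  have hP1 := isProbabilityMeasure_pointLaw (μ := μ) (k := k) (g := (id : X × X → X × X))
    measurable_id
  have hfin1 : klDiv (pointLaw id μ k) (M₀.prod u) ≠ ∞ := by
    refine ne_top_of_le_ne_top (hfin (k + 1) hk) ?_
    rw [klDiv_pointLaw_eq_add]; exact le_add_self
  obtain ⟨φ, hφ, hdens, h1⟩ := exists_density_of_klDiv_ne_top (pointLaw id μ k) u
    (by rwa [map_fst_pointLaw measurable_id])
  rw [map_fst_pointLaw measurable_id] at hdens h1
  have hc : ((m - k : ℕ) : ℝ≥0∞) / m ≤ 1 :=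
    ENNReal.div_le_of_le_mul (by rw [one_mul]; exact_mod_cast Nat.sub_le m k)
  obtain ⟨Q, hQ, hQobl, hQT⟩ := exists_oblivious_mixture M₀ D κ hφ h1 hc hρ hρm
    (h.lintegral_cost_le hρm hcost hk hφ hdens) n
  refine ⟨Q, hQ, hQobl, fun T hT hT1 t t' ht ht' => ?_⟩
  set G := (M₀.prod (Measure.pi fun _ : Fin n => u)).withDensity (fun p => ∏ i, φ (p.1, p.2 i))
    with hG
  have hGp : IsProbabilityMeasure G := isProbabilityMeasure_prod_pi_density M₀ u hφ h1
  have hBp := isProbabilityMeasure_blockLaw (μ := μ) (k := k) (l := n) (g := (id : X × X → X × X))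
    measurable_id
  -- the block given the first `k` pairs is close to a product
  have hKL : klDiv (blockLaw id μ k n) G ≤ τ := by
    have hblk := klDiv_initialLaw_add (μ := μ) (k := k) (l := n) u
    have hfinb : klDiv (blockLaw id μ k n) (M₀.prod (Measure.pi fun _ : Fin n => u)) ≠ ∞ := by
      refine ne_top_of_le_ne_top (hfin (k + n) hkn) ?_
      rw [hblk]; exact le_add_self
    have hcomp := h.klDiv_blockLaw_eq_add measurable_id hkn u hφ h1 hdens hfinb
    rw [hblk, ← hcomp, add_assoc] at hτ
    have h2 := (ENNReal.add_le_add_iff_left (hfin k hk.le)).1 hτ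
    rw [add_comm] at h2
    exact (ENNReal.add_le_add_iff_left
      (ENNReal.mul_ne_top (ENNReal.natCast_ne_top n) hfin1)).1 h2
  -- the conditional law of a clean point given the first `k` pairs is close to `D`
  set q := marginalDensity κ φ with hq
  have hqm : Measurable q := measurable_marginalDensity hφ
  have hpt : pointLaw Prod.fst μ k = (M₀.prod D).withDensity q := by
    rw [hq, ← map_withDensity_marginalDensity M₀ D κ hφ, ← hu, ← hdens, pointLaw, pointLaw,
      Measure.map_map (by fun_prop) (by fun_prop)]
    rfl
  have hP2 : IsProbabilityMeasure ((M₀.prod D).withDensity q) := by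
    rw [← hpt]; exact isProbabilityMeasure_pointLaw measurable_fst
  have hq1 : ∀ᵐ a ∂M₀, ∫⁻ x, q (a, x) ∂D = 1 := by
    filter_upwards [h1] with a ha
    rw [← ha, hu, Measure.lintegral_compProd (by fun_prop)]
    rfl
  have hS : klDiv ((M₀.prod D).withDensity q) (M₀.prod D)
      ≤ ENNReal.ofReal (k * Real.log d) / ((m - k : ℕ) : ℝ≥0∞) := by
    -- By the chain rule, the clean points given the first `k` pairs have no more divergence than
    -- the whole block; that is at most `k log d`, however many clean points follow.
    have hle : klDiv (blockLaw Prod.fst μ k (m - k))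
        (M₀.prod (Measure.pi fun _ : Fin (m - k) => D)) ≤ ENNReal.ofReal (k * Real.log d) := by
      refine le_trans ?_ (klDiv_blockLaw_fst_le hd (hdom k (m - k) (by omega)))
      rw [klDiv_blockLaw_chain measurable_fst]
      exact le_add_self
    -- The compensation identity shares this bound equally among the `m - k` clean points.
    have hcomp := h.klDiv_blockLaw_eq_add (l := m - k) measurable_fst (by omega) D hqm hq1 hpt
      (ne_top_of_le_ne_top ENNReal.ofReal_ne_top hle)
    have hmk : m - k ≠ 0 := by omega
    rw [ENNReal.le_div_iff_mul_le (Or.inl (by exact_mod_cast hmk))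
      (Or.inl (ENNReal.natCast_ne_top _)), mul_comm, ← hpt]
    exact le_trans (by rw [← hcomp]; exact le_add_self) hle
  have hTm : Measurable (fun p : (Fin k → X × X) × (Fin n → X × X) => T (fun i => (p.2 i).2)) := by
    fun_prop
  have hadapt : ∫⁻ x, T x ∂(μ.map fun z (i : Fin n) => (z i).2)
      = ∫⁻ p, T (fun i => (p.2 i).2) ∂(blockLaw id μ k n) := by
    -- Exchangeability moves the subsample from positions `0, …, n - 1` to `k, …, k + n - 1`.
    have hex := h n (fun i => k + i) (fun i j hij => by simpa [Fin.ext_iff] using hij)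
      (fun i => by omega)
    have hS2 : Measurable fun (w : Fin n → X × X) (i : Fin n) => (w i).2 := by fun_prop
    have e1 := congrArg (Measure.map fun (w : Fin n → X × X) (i : Fin n) => (w i).2) hex
    rw [Measure.map_map hS2 (by fun_prop), Measure.map_map hS2 (by fun_prop)] at e1
    have e2 : (μ.map fun z (i : Fin n) => (z i).2) = μ.map fun z (i : Fin n) => (z (k + i)).2 :=
      e1.symm
    rw [e2, lintegral_map hT (by fun_prop), blockLaw, lintegral_map hTm (by fun_prop)]
    rfl
  rw [hadapt]
  refine (lintegral_le_add_klDiv _ G ht hTm fun p => hT1 _).trans ?_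
  refine (add_le_add_left (hQT T hT hT1) _).trans ?_
  rw [add_assoc, add_comm (_ * _) (_ + _)]
  gcongr
  refine (lintegral_one_sub_density_le (M₀.prod D) hqm ht').trans ?_
  gcongr

end Core

/-! ### Symmetrization -/

section Symmetrization

/-- Some permutation carries `e'` to `e`; reindex the sum by it. -/
lemma sum_perm_trans {m n : ℕ} {M : Type*} [AddCommMonoid M] (F : (Fin n ↪ Fin m) → M)
    (e e' : Fin n ↪ Fin m) :
    ∑ σ : Equiv.Perm (Fin m), F (e.trans σ.toEmbedding)
      = ∑ σ : Equiv.Perm (Fin m), F (e'.trans σ.toEmbedding) := by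
  obtain ⟨τ, hτ⟩ := Equiv.Perm.exists_extending_pair e' e e'.injective e.injective
  rw [← Equiv.sum_comp (Equiv.mulRight τ) fun σ : Equiv.Perm (Fin m) => F (e'.trans σ.toEmbedding)]
  refine Finset.sum_congr rfl fun σ _ => ?_
  congr 1
  ext i
  simp [hτ]

/-- Double counting: a fixed injection followed by a uniform permutation is a uniform injection.
This identifies sampling without replacement with reading the first `n` shuffled entries. -/
lemma card_smul_sum_embedding {m n : ℕ} {M : Type*} [AddCommMonoid M] (F : (Fin n ↪ Fin m) → M)
    (e : Fin n ↪ Fin m) :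
    Fintype.card (Equiv.Perm (Fin m)) • ∑ e' : Fin n ↪ Fin m, F e'
      = Fintype.card (Fin n ↪ Fin m) •
        ∑ σ : Equiv.Perm (Fin m), F (e.trans σ.toEmbedding) := by
  have h1 : ∀ σ : Equiv.Perm (Fin m),
      ∑ e' : Fin n ↪ Fin m, F (e'.trans σ.toEmbedding) = ∑ e' : Fin n ↪ Fin m, F e' := fun σ =>
    Equiv.sum_comp (Equiv.embeddingCongr (Equiv.refl _) σ) F
  calc _ = ∑ σ : Equiv.Perm (Fin m), ∑ e' : Fin n ↪ Fin m, F (e'.trans σ.toEmbedding) := by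
        simp [h1]
    _ = ∑ e' : Fin n ↪ Fin m, ∑ σ : Equiv.Perm (Fin m), F (e'.trans σ.toEmbedding) :=
        Finset.sum_comm
    _ = _ := by
        rw [Finset.sum_congr rfl fun e' _ => sum_perm_trans F e' e]
        simp

variable {X : Type*} [MeasurableSpace X] {m n : ℕ}

/-- The sequence of pairs read off along `σ` from a pair of `m`-tuples, padded by `y₀`. -/
def pairSequence (y₀ : X × X) (σ : Equiv.Perm (Fin m)) (p : (Fin m → X) × (Fin m → X)) (i : ℕ) :
    X × X :=
  if h : i < m then (p.1 (σ ⟨i, h⟩), p.2 (σ ⟨i, h⟩)) else y₀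

lemma measurable_pairSequence (y₀ : X × X) (σ : Equiv.Perm (Fin m)) :
    Measurable (pairSequence y₀ σ) := by
  refine measurable_pi_iff.2 fun i => ?_
  unfold pairSequence
  by_cases h : i < m
  · simp only [h, dif_pos]; fun_prop
  · simp only [h, dif_neg, not_false_eq_true]; fun_prop

/-- The law of the pairs of a coupling, in uniformly random order. -/
def symmetrizedLaw (y₀ : X × X) (π : Measure ((Fin m → X) × (Fin m → X))) :
    Measure (ℕ → X × X) :=
  (Fintype.card (Equiv.Perm (Fin m)) : ℝ≥0∞)⁻¹ •
    ∑ σ : Equiv.Perm (Fin m), π.map (pairSequence y₀ σ)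

variable {y₀ : X × X} {π : Measure ((Fin m → X) × (Fin m → X))}

lemma card_perm_inv_mul_cancel (m : ℕ) :
    (Fintype.card (Equiv.Perm (Fin m)) : ℝ≥0∞)⁻¹ * Fintype.card (Equiv.Perm (Fin m)) = 1 :=
  ENNReal.inv_mul_cancel (by exact_mod_cast Fintype.card_ne_zero) (ENNReal.natCast_ne_top _)

lemma map_symmetrizedLaw {Z : Type*} [MeasurableSpace Z] {f : (ℕ → X × X) → Z}
    (hf : Measurable f) :
    (symmetrizedLaw y₀ π).map f = (Fintype.card (Equiv.Perm (Fin m)) : ℝ≥0∞)⁻¹ •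
      ∑ σ : Equiv.Perm (Fin m), π.map (fun p => f (pairSequence y₀ σ p)) := by
  rw [symmetrizedLaw, Measure.map_smul, Measure.map_finset_sum' hf.aemeasurable]
  congr 1
  refine Finset.sum_congr rfl fun σ _ => ?_
  rw [Measure.map_map hf (measurable_pairSequence y₀ σ)]
  rfl

instance [IsProbabilityMeasure π] : IsProbabilityMeasure (symmetrizedLaw y₀ π) := by
  refine ⟨?_⟩
  have : ∀ σ : Equiv.Perm (Fin m), IsProbabilityMeasure (π.map (pairSequence y₀ σ)) := fun σ =>
    Measure.isProbabilityMeasure_map (measurable_pairSequence y₀ σ).aemeasurable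
  rw [symmetrizedLaw, Measure.smul_apply, Measure.finsetSum_apply]
  simp only [measure_univ, Finset.sum_const, Finset.card_univ, smul_eq_mul, nsmul_eq_mul, mul_one]
  exact card_perm_inv_mul_cancel m

lemma isExchangeableBelow_symmetrizedLaw : IsExchangeableBelow m (symmetrizedLaw y₀ π) := by
  intro k e he hem
  have hkm : k ≤ m := by
    have := Fintype.card_le_of_injective (fun i : Fin k => (⟨e i, hem i⟩ : Fin m))
      (fun i j hij => he (by simpa using hij))
    simpa using this
  rw [map_symmetrizedLaw (by fun_prop), map_symmetrizedLaw (by fun_prop)]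
  congr 1
  have h := sum_perm_trans (fun e : Fin k ↪ Fin m =>
      π.map (fun p (i : Fin k) => (p.1 (e i), p.2 (e i))))
    ⟨fun i => ⟨e i, hem i⟩, fun i j hij => he (by simpa using hij)⟩ (Fin.castLEEmb hkm)
  have e1 : ∀ σ : Equiv.Perm (Fin m), (fun p (i : Fin k) => pairSequence y₀ σ p (e i))
      = fun p i => (p.1 (σ ⟨e i, hem i⟩), p.2 (σ ⟨e i, hem i⟩)) := by
    intro σ; funext p i; simp [pairSequence, hem i]
  have e2 : ∀ σ : Equiv.Perm (Fin m), (fun p (i : Fin k) => pairSequence y₀ σ p i)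
      = fun p i => (p.1 (σ (Fin.castLE hkm i)), p.2 (σ (Fin.castLE hkm i))) := by
    intro σ; funext p i
    have hi : (i : ℕ) < m := by omega
    simp only [pairSequence, hi, dif_pos]
    rfl
  simp only [e1, e2]
  exact h

lemma subsample_eq_map_symmetrizedLaw (hnm : n ≤ m) :
    subsample n (π.map Prod.snd) = (symmetrizedLaw y₀ π).map fun z (i : Fin n) => (z i).2 := by
  rw [map_symmetrizedLaw (by fun_prop), subsample]
  set F : (Fin n ↪ Fin m) → Measure (Fin n → X) := fun e => π.map (fun p i => p.2 (e i)) with hF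
  have h1 : ∀ e : Fin n ↪ Fin m, (π.map Prod.snd).map (fun S i => S (e i)) = F e := fun e => by
    rw [Measure.map_map (by fun_prop) measurable_snd]; rfl
  have h2 : ∀ σ : Equiv.Perm (Fin m),
      π.map (fun p (i : Fin n) => (pairSequence y₀ σ p i).2)
        = F ((Fin.castLEEmb hnm).trans σ.toEmbedding) := fun σ => by
    rw [hF]
    congr 1
    ext p i
    have : (i : ℕ) < m := by omega
    simp [pairSequence, this]
    rfl
  simp only [h1, h2]
  have h := card_smul_sum_embedding F (Fin.castLEEmb hnm)
  have hne : Nonempty (Fin n ↪ Fin m) := ⟨Fin.castLEEmb hnm⟩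
  refine Measure.ext fun s _ => ?_
  have hs := congrArg (fun μ : Measure (Fin n → X) => μ s) h
  simp only [Measure.smul_apply, nsmul_eq_mul, smul_eq_mul] at hs ⊢
  have hE : (Fintype.card (Fin n ↪ Fin m) : ℝ≥0∞) ≠ 0 := by exact_mod_cast Fintype.card_ne_zero
  have hE' : (Fintype.card (Fin n ↪ Fin m) : ℝ≥0∞) ≠ ∞ := ENNReal.natCast_ne_top _
  rw [← one_mul ((∑ e, F e) s), ← card_perm_inv_mul_cancel m, mul_assoc, hs, mul_left_comm,
    ← mul_assoc _ _ (Measure.instFunLike.coe _ s), ENNReal.inv_mul_cancel hE hE', one_mul]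

lemma map_perm_pi (D : Measure X) [IsProbabilityMeasure D] (σ : Equiv.Perm (Fin m)) :
    (Measure.pi fun _ : Fin m => D).map (fun s i => s (σ i)) = Measure.pi fun _ : Fin m => D := by
  symm
  refine Measure.pi_eq fun t ht => ?_
  rw [Measure.map_apply (by fun_prop) (MeasurableSet.univ_pi ht)]
  have : (fun (s : Fin m → X) i => s (σ i)) ⁻¹' Set.univ.pi t
      = Set.univ.pi fun i => t (σ.symm i) := by
    ext s
    simp only [Set.mem_preimage, Set.mem_pi, Set.mem_univ, true_imp_iff]
    exact ⟨fun h i => by simpa using h (σ.symm i), fun h i => by simpa using h (σ i)⟩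
  rw [this, Measure.pi_pi]
  exact Equiv.prod_comp σ.symm fun i => D (t i)

lemma map_fst_symmetrizedLaw {D : Measure X} [IsProbabilityMeasure D]
    (hπ : π.map Prod.fst = Measure.pi fun _ : Fin m => D) :
    (symmetrizedLaw y₀ π).map (fun z (i : Fin m) => (z i).1) = Measure.pi fun _ : Fin m => D := by
  rw [map_symmetrizedLaw (by fun_prop)]
  have h : ∀ σ : Equiv.Perm (Fin m),
      π.map (fun p (i : Fin m) => (pairSequence y₀ σ p i).1) = Measure.pi fun _ : Fin m => D := by
    intro σ
    rw [← map_perm_pi D σ, ← hπ, Measure.map_map (by fun_prop) measurable_fst]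
    congr 1
    ext p i
    simp [pairSequence]
  simp only [h, Finset.sum_const, Finset.card_univ]
  refine Measure.ext fun s _ => ?_
  simp only [Measure.smul_apply, nsmul_eq_mul, smul_eq_mul]
  rw [← mul_assoc, card_perm_inv_mul_cancel, one_mul]

lemma ae_symmetrizedLaw_cost {ρ : X → X → ℝ≥0∞}
    (hρm : Measurable (fun p : X × X => ρ p.1 p.2)) (hm : m ≠ 0)
    (h : ∀ᵐ p ∂π, p.2 ∈ sampleCorruptions ρ p.1) :
    ∀ᵐ z ∂(symmetrizedLaw y₀ π), ∑ i ∈ Finset.range m, ρ (z i).1 (z i).2 ≤ m := by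
  refine Measure.ae_smul_measure ?_ _
  rw [ae_finsetSum_measure_iff]
  intro σ _
  have hmeas : MeasurableSet
      {z : ℕ → X × X | ∑ i ∈ Finset.range m, ρ (z i).1 (z i).2 ≤ m} := by
    refine measurableSet_le (Finset.measurable_fun_sum _ fun i _ => ?_) measurable_const
    exact hρm.comp (measurable_pi_apply i)
  rw [ae_map_iff (measurable_pairSequence y₀ σ).aemeasurable hmeas]
  filter_upwards [h] with p hp
  rw [Finset.sum_range]
  have : ∀ i : Fin m, ρ (pairSequence y₀ σ p i).1 (pairSequence y₀ σ p i).2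
      = ρ (p.1 (σ i)) (p.2 (σ i)) := fun i => by simp [pairSequence]
  simp only [this]
  rw [Equiv.sum_comp σ fun i => ρ (p.1 i) (p.2 i)]
  have hm0 : (m : ℝ≥0∞) ≠ 0 := by exact_mod_cast hm
  have hp' : (m : ℝ≥0∞)⁻¹ * ∑ i, ρ (p.1 i) (p.2 i) ≤ 1 := hp
  rwa [mul_comm, ← div_eq_mul_inv, ENNReal.div_le_iff hm0 (ENNReal.natCast_ne_top m), one_mul] at hp'

end Symmetrization

/-! ### Domination of the law of an exchangeable corruption -/

section Domination

variable {X : Type*} [MeasurableSpace X] {D : Measure X} [IsProbabilityMeasure D] {m : ℕ}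
  {μ : Measure (ℕ → X × X)}

lemma map_fst_initial (hμ : μ.map (fun z (i : Fin m) => (z i).1) = Measure.pi fun _ : Fin m => D)
    {k : ℕ} (hk : k ≤ m) :
    μ.map (fun z (i : Fin k) => (z i).1) = Measure.pi fun _ : Fin k => D := by
  obtain ⟨r, rfl⟩ := Nat.exists_eq_add_of_le hk
  have h := congrArg (Measure.map Prod.fst)
    (congrArg (Measure.map (splitEquiv X k r)) hμ)
  rw [map_splitEquiv_pi, Measure.map_map (splitEquiv X k r).measurable (by fun_prop),
    Measure.map_map measurable_fst (by fun_prop), Measure.map_fst_prod, measure_univ, one_smul] at h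
  exact h

lemma map_fst_split (hμ : μ.map (fun z (i : Fin m) => (z i).1) = Measure.pi fun _ : Fin m => D)
    {k l : ℕ} (hkl : k + l ≤ m) :
    μ.map (fun z => (fun i : Fin k => (z i).1, fun j : Fin l => (z (k + j)).1))
      = (Measure.pi fun _ : Fin k => D).prod (Measure.pi fun _ : Fin l => D) := by
  rw [← map_splitEquiv_pi, ← map_fst_initial hμ hkl,
    Measure.map_map (splitEquiv X k l).measurable (by fun_prop)]
  rfl

/-- A bounded total cost forces every single cost to be finite, so pair 0 lives on a set with fibres
of size at most `d`. All pairs share its law, so one kernel serves them all. -/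
lemma IsExchangeableBelow.exists_kernel [StandardBorelSpace X] [IsProbabilityMeasure μ]
    (h : IsExchangeableBelow m μ) {ρ : X → X → ℝ≥0∞}
    (hcost : ∀ᵐ z ∂μ, ∑ i ∈ Finset.range m, ρ (z i).1 (z i).2 ≤ m)
    (hρm : Measurable (fun p : X × X => ρ p.1 p.2)) {d : ℕ} (hd : costDegree ρ ≤ d) (hm : 0 < m) :
    ∃ κ : Kernel X X, IsMarkovKernel κ ∧
      ∀ i < m, ∀ᵐ z ∂μ, (d : ℝ≥0∞)⁻¹ ≤ κ (z i).1 {(z i).2} := by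
  have h0 : ∀ᵐ z ∂μ, ρ (z 0).1 (z 0).2 ≠ ∞ := by
    filter_upwards [hcost] with z hz
    have h1 : ρ (z 0).1 (z 0).2 ≤ ∑ i ∈ Finset.range m, ρ (z i).1 (z i).2 :=
      Finset.single_le_sum (f := fun i => ρ (z i).1 (z i).2) (fun _ _ => zero_le)
        (Finset.mem_range.2 hm)
    exact ne_top_of_le_ne_top (ENNReal.natCast_ne_top m) (h1.trans hz)
  have hmeas : Measurable fun z : ℕ → X × X => z 0 := measurable_pi_apply 0
  have hP : IsProbabilityMeasure (μ.map fun z => z 0) :=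
    Measure.isProbabilityMeasure_map hmeas.aemeasurable
  have hS : MeasurableSet {p : X × X | ρ p.1 p.2 ≠ ∞} :=
    (hρm (measurableSet_singleton ∞)).compl
  obtain ⟨κ, hκ, hae⟩ := exists_kernel_le_singleton (μ.map fun z => z 0)
    (S := {p : X × X | ρ p.1 p.2 ≠ ∞})
    ((ae_map_iff (p := fun p => p ∈ {p : X × X | ρ p.1 p.2 ≠ ∞}) hmeas.aemeasurable hS).2 h0)
    (d := d) (fun x => (le_iSup (fun x : X => {y : X | ρ x y ≠ ∞}.encard) x).trans hd)
  refine ⟨κ, hκ, fun i hi => ?_⟩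
  have hi' : μ.map (fun z => z i) = μ.map (fun z => z 0) := by
    have := congrArg (Measure.map fun w : Fin 1 → X × X => w 0)
      (h 1 (fun _ => i) (Function.injective_of_subsingleton _) (fun _ => hi))
    rwa [Measure.map_map (by fun_prop) (by fun_prop), Measure.map_map (by fun_prop) (by fun_prop)]
      at this
  rw [← hi'] at hae
  exact ae_of_ae_map (measurable_pi_apply i).aemeasurable hae

/-- Given all the clean points involved, the first `k` corrupted points form an atom of mass at
least `d⁻¹ ^ k` under the product kernel. The further clean points are exactly independent with law
`D` and contribute no factor. -/
lemma blockLaw_fst_le [StandardBorelSpace X] [IsProbabilityMeasure μ]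
    (hμ : μ.map (fun z (i : Fin m) => (z i).1) = Measure.pi fun _ : Fin m => D)
    (κ : Kernel X X) [IsMarkovKernel κ] {d : ℕ}
    (hκ : ∀ i < m, ∀ᵐ z ∂μ, (d : ℝ≥0∞)⁻¹ ≤ κ (z i).1 {(z i).2}) {k l : ℕ} (hkl : k + l ≤ m) :
    blockLaw Prod.fst μ k l ≤ (d : ℝ≥0∞) ^ k •
      (Measure.pi fun _ : Fin k => D ⊗ₘ κ).prod (Measure.pi fun _ : Fin l => D) := by
  have : Nonempty X := (nonempty_of_isProbabilityMeasure μ).map fun z => (z 0).1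
  set w : (ℕ → X × X) → ((Fin k → X) × (Fin l → X)) × (Fin k → X) := fun z =>
    ((fun i => (z i).1, fun j => (z (k + j)).1), fun i => (z i).2) with hw
  have hwm : Measurable w := by fun_prop
  set Λ := piKernel (fun i : Fin k => κ.comap (fun s : Fin k → X => s i) (measurable_pi_apply i))
    with hΛ
  have hP : IsProbabilityMeasure (μ.map w) := Measure.isProbabilityMeasure_map hwm.aemeasurable
  have hfst : (μ.map w).fst
      = (Measure.pi fun _ : Fin k => D).prod (Measure.pi fun _ : Fin l => D) := by
    rw [Measure.fst, Measure.map_map measurable_fst hwm, ← map_fst_split hμ hkl]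
    rfl
  have hle : μ.map w ≤ (d : ℝ≥0∞) ^ k • ((μ.map w).fst ⊗ₘ Λ.comap Prod.fst measurable_fst) := by
    refine le_smul_compProd _ _ (ENNReal.pow_ne_top (ENNReal.natCast_ne_top d)) ?_
    rw [ae_map_iff hwm.aemeasurable
      (measurableSet_le measurable_const (measurable_kernel_singleton _))]
    have hall : ∀ᵐ z ∂μ, ∀ i : Fin k, (d : ℝ≥0∞)⁻¹ ≤ κ (z i).1 {(z i).2} :=
      ae_all_iff.2 fun i => hκ i (by omega)
    filter_upwards [hall] with z hz
    rw [Kernel.comap_apply, hΛ, piKernel_apply, Measure.pi_singleton, ENNReal.inv_pow]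
    calc ((d : ℝ≥0∞)⁻¹) ^ k = ∏ _i : Fin k, (d : ℝ≥0∞)⁻¹ := by simp
      _ ≤ _ := Finset.prod_le_prod' fun i _ => hz i
  have hg : Measurable fun (p : (Fin k → X) × (Fin k → X)) (i : Fin k) => (p.1 i, p.2 i) := by
    fun_prop
  have hG : Measurable fun p : ((Fin k → X) × (Fin l → X)) × (Fin k → X) =>
      ((fun (q : (Fin k → X) × (Fin k → X)) (i : Fin k) => (q.1 i, q.2 i)) (p.1.1, p.2), p.1.2) := by
    fun_prop
  have h2 := Measure.map_mono hle hG
  rw [Measure.map_smul, hfst, map_prod_compProd_comap_fst _ _ Λ hg, map_zip_compProd_piKernel,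
    Measure.map_map hG hwm] at h2
  exact h2

end Domination

/-! ### Choice of the number of conditioned pairs -/

/-- With `δ k = A (k + 1) - A k`, the defect is the sum over `j < n` of `δ (k + j) - δ k`. For fixed
`j`, summing over `k < K` leaves the last `j` increments minus the first `j`, at most `j * B`. -/
lemma sum_increment_defect_le (A : ℕ → ℝ) {n K : ℕ} {B : ℝ}
    (h0 : ∀ k < K + n, 0 ≤ A (k + 1) - A k) (hB : ∀ k < K + n, A (k + 1) - A k ≤ B) :
    ∑ k ∈ Finset.range K, (A (k + n) - A k - n * (A (k + 1) - A k)) ≤ n * (n * B) := by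
  have hterm : ∀ k, A (k + n) - A k - n * (A (k + 1) - A k)
      = ∑ j ∈ Finset.range n, ((A (j + k + 1) - A (j + k)) - (A (k + 1) - A k)) := by
    intro k
    rw [Finset.sum_sub_distrib]
    have := Finset.sum_range_sub (fun j => A (j + k)) n
    simp only [zero_add, Finset.sum_const, Finset.card_range, nsmul_eq_mul] at this ⊢
    rw [← add_comm n k, ← this]
    congr 1
    exact Finset.sum_congr rfl fun j _ => by rw [add_right_comm]
  simp only [hterm]
  rw [Finset.sum_comm]
  calc _ ≤ ∑ _j ∈ Finset.range n, (n * B : ℝ) := by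
        refine Finset.sum_le_sum fun j hj => ?_
        rw [Finset.mem_range] at hj
        have hB0 : 0 ≤ B := (h0 j (by omega)).trans (hB j (by omega))
        rw [Finset.sum_sub_distrib]
        have e1 := Finset.sum_range_add (fun i => A (i + 1) - A i) j K
        have e2 := Finset.sum_range_add (fun i => A (i + 1) - A i) K j
        rw [add_comm K j] at e2
        have h1 : 0 ≤ ∑ i ∈ Finset.range j, (A (i + 1) - A i) :=
          Finset.sum_nonneg fun i hi => h0 i (by rw [Finset.mem_range] at hi; omega)
        have h2 : ∑ i ∈ Finset.range j, (A (K + i + 1) - A (K + i)) ≤ j * B := by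
          calc _ ≤ ∑ i ∈ Finset.range j, B :=
                Finset.sum_le_sum fun i hi => hB _ (by rw [Finset.mem_range] at hi; omega)
            _ = j * B := by simp
        have h3 : (j : ℝ) * B ≤ n * B := by gcongr
        linarith
    _ = n * (n * B) := by simp

lemma exists_index_of_superadditive {A : ℕ → ℝ} {L ε : ℝ} {n m : ℕ} (hA0 : ∀ k, 0 ≤ A k)
    (hAle : ∀ k ≤ m, A k ≤ k * L)
    (hsup : ∀ k l, k < m → k + l ≤ m → A k + l * (A (k + 1) - A k) ≤ A (k + l))
    (hmono : ∀ k < m, A k ≤ A (k + 1)) (hn : 0 < n) (hnm : n ≤ m) (hε : 0 < ε) (hε1 : ε ≤ 1)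
    (hm : 4096 * ((n : ℝ) ^ 4 * L ^ 2 / ε ^ 4) ≤ m) (hL : L = 0 ∨ 1 / 2 ≤ L) :
    ∃ k, k < m ∧ k + n ≤ m ∧ ∃ τ, 0 ≤ τ ∧ A (k + n) ≤ A k + n * (A (k + 1) - A k) + τ ∧
      (τ * (ε / 4)⁻¹ + ε / 4) + n * ((k : ℝ) / m
        + (k * L / (m - k) * (ε / (8 * n))⁻¹ + ε / (8 * n))) ≤ ε := by
  have hn' : (1 : ℝ) ≤ n := by exact_mod_cast hn
  rcases hL with rfl | hL
  · refine ⟨0, by omega, by omega, 0, le_rfl, ?_, ?_⟩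
    · have h1 : A (0 + n) ≤ 0 := by simpa using hAle (0 + n) (by omega)
      have h2 := hmono 0 (by omega)
      have h3 : (0 : ℝ) ≤ n * (A (0 + 1) - A 0) := mul_nonneg (by linarith) (by linarith)
      linarith [hA0 0]
    · have : (n : ℝ) * (ε / (8 * n)) = ε / 8 := by field_simp
      simp only [Nat.cast_zero, zero_mul, zero_div, zero_add, this]
      linarith
  -- In terms of `x`, the index ranges over `k < ⌈32 x⌉` and the sample size satisfies `m ≥ 4096
  -- x²`. The bound `L ≥ 1/2` gives `x ≥ 1/2` and `n ≤ 2 x`, so `K + n ≤ m / 2`.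
  set x : ℝ := n ^ 2 * L / ε ^ 2 with hx
  have hε2 : ε ^ 2 ≤ 1 := pow_le_one₀ hε.le hε1
  have hnn : (n : ℝ) ≤ n ^ 2 := by nlinarith
  have hxn : (n : ℝ) ≤ 2 * x := by
    have : n ^ 2 * L ≤ x := by
      rw [hx, le_div_iff₀ (by positivity)]
      exact mul_le_of_le_one_right (by positivity) hε2
    nlinarith
  have hx0 : 1 / 2 ≤ x := by linarith
  have hmx : 4096 * x ^ 2 ≤ m := by
    refine le_trans (le_of_eq ?_) hm
    rw [hx]; field_simp
  have hxε : x * ε ^ 2 = n ^ 2 * L := by rw [hx]; field_simp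
  set K := ⌈32 * x⌉₊ with hK
  have hKle : (K : ℝ) ≤ 32 * x + 1 := (Nat.ceil_lt_add_one (by linarith)).le
  have hKge : 32 * x ≤ K := Nat.le_ceil _
  have hK0 : 0 < K := Nat.ceil_pos.2 (by linarith)
  have hKn : ((K + n : ℕ) : ℝ) ≤ m / 2 := by push_cast; nlinarith
  have hKm : K + n ≤ m := by
    have : ((K + n : ℕ) : ℝ) ≤ m := by linarith [(Nat.cast_nonneg m : (0 : ℝ) ≤ m)]
    exact_mod_cast this
  have hm0 : (0 : ℝ) < m := by nlinarith
  -- Superadditivity from `k` to `m` gives `(m - k) (A (k + 1) - A k) ≤ A m ≤ m L`, and here `k ≤ m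
  -- / 2`.
  have hB : ∀ k < K + n, A (k + 1) - A k ≤ 2 * L := by
    intro k hk
    have hkm : k < m := by omega
    have h1 := hsup k (m - k) hkm (by omega)
    rw [Nat.add_sub_cancel' hkm.le, Nat.cast_sub hkm.le] at h1
    have h2 := hAle m le_rfl
    have h3 : (k : ℝ) ≤ m / 2 := by
      have : (k : ℝ) ≤ ((K + n : ℕ) : ℝ) := by exact_mod_cast hk.le
      linarith
    have h4 := hmono k hkm
    have h5 : (m : ℝ) / 2 * (A (k + 1) - A k) ≤ (m - k) * (A (k + 1) - A k) :=
      mul_le_mul_of_nonneg_right (by linarith) (by linarith)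
    have h6 : (m : ℝ) / 2 * (A (k + 1) - A k) ≤ m / 2 * (2 * L) := by linarith [hA0 k]
    exact le_of_mul_le_mul_left h6 (by linarith)
  have hsum := sum_increment_defect_le A (n := n) (K := K) (B := 2 * L)
    (fun k hk => by linarith [hmono k (by omega)]) hB
  -- The total defect is at most `2 n² L = 2 x ε²`, and `K ≥ 32 x`, so the average is at most `ε² /
  -- 16`.
  have hτ : (n : ℝ) * (n * (2 * L)) ≤ K * (ε ^ 2 / 16) := by nlinarith
  obtain ⟨k, hk, hkle⟩ : ∃ k ∈ Finset.range K,
      A (k + n) - A k - n * (A (k + 1) - A k) ≤ ε ^ 2 / 16 := by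
    refine Finset.exists_le_of_sum_le (Finset.nonempty_range_iff.2 hK0.ne') ?_
    refine (hsum.trans hτ).trans (le_of_eq ?_)
    simp
  rw [Finset.mem_range] at hk
  refine ⟨k, by omega, by omega, ε ^ 2 / 16, by positivity, by linarith, ?_⟩
  have hk32 : (k : ℝ) ≤ 32 * x := (Nat.lt_ceil.1 hk).le
  have hk2 : (k : ℝ) ≤ m / 2 := by
    have : (k : ℝ) ≤ ((K + n : ℕ) : ℝ) := by exact_mod_cast (by omega : k ≤ K + n)
    linarith
  have hkm : (k : ℝ) / m ≤ 1 / (128 * x) := by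
    rw [div_le_div_iff₀ hm0 (by linarith)]
    nlinarith
  have hx1 : 1 / x * (n ^ 2 * L) = ε ^ 2 := by rw [hx]; field_simp
  have hnkm : (n : ℝ) * (k / m) ≤ ε / 64 := by
    have h1 : (n : ℝ) * (k / m) ≤ n * (1 / (128 * x)) := by gcongr
    have h2 : (n : ℝ) * (1 / (128 * x)) = ε ^ 2 / (128 * (n * L)) := by
      rw [hx]; field_simp
    have h3 : ε ^ 2 / (128 * (n * L)) ≤ ε / 64 := by
      rw [div_le_div_iff₀ (by positivity) (by norm_num)]
      have : 1 / 2 ≤ n * L := by nlinarith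
      nlinarith
    linarith
  have hkL : k * L / (m - k) ≤ ε ^ 2 / (64 * n ^ 2) := by
    have h1 : k * L / (m - k) ≤ k * L / (m / 2) := by
      gcongr
      linarith
    have h2 : k * L / (m / 2) = 2 * L * (k / m) := by field_simp
    have h3 : 2 * L * (k / m) ≤ 2 * L * (1 / (128 * x)) := by gcongr
    have h4 : 2 * L * (1 / (128 * x)) = ε ^ 2 / (64 * n ^ 2) := by
      rw [hx]; field_simp; norm_num
    linarith
  have hlast : (n : ℝ) * (k * L / (m - k) * (ε / (8 * n))⁻¹) ≤ ε / 8 := by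
    calc _ ≤ (n : ℝ) * (ε ^ 2 / (64 * n ^ 2) * (ε / (8 * n))⁻¹) := by gcongr
      _ = ε / 8 := by field_simp; norm_num
  have e1 : ε ^ 2 / 16 * (ε / 4)⁻¹ = ε / 4 := by field_simp; norm_num
  have e2 : (n : ℝ) * (ε / (8 * n)) = ε / 8 := by field_simp
  -- The budget is `ε/4 + ε/4` for near-independence, `ε/64` for the scaling and `ε/8 + ε/8` for the
  -- marginal.
  rw [mul_add, mul_add, e1, e2]
  linarith

/-! ### Total variation distance -/

lemma tvDist_le_of_lintegral_le {Y : Type*} [MeasurableSpace Y] {μ ν : Measure Y}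
    [IsProbabilityMeasure μ] [IsProbabilityMeasure ν] {ε : ℝ} (hε : 0 ≤ ε)
    (h : ∀ T : Y → ℝ≥0∞, Measurable T → (∀ y, T y ≤ 1) →
      ∫⁻ y, T y ∂μ ≤ ∫⁻ y, T y ∂ν + ENNReal.ofReal ε) : tvDist μ ν ≤ ε := by
  refine Real.iSup_le (fun T => ?_) hε
  obtain ⟨T, hT, hT01⟩ := T
  have hle : ∀ y, ENNReal.ofReal (T y) ≤ 1 := fun y => by
    rw [← ENNReal.ofReal_one]; exact ENNReal.ofReal_le_ofReal (hT01 y).2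
  have hν : ∫⁻ y, ENNReal.ofReal (T y) ∂ν ≠ ∞ := by
    refine ne_top_of_le_ne_top ENNReal.one_ne_top ((lintegral_mono hle).trans ?_)
    simp
  have hm := h (fun y => ENNReal.ofReal (T y)) hT.ennreal_ofReal hle
  have h2 := ENNReal.toReal_mono (ENNReal.add_ne_top.2 ⟨hν, ENNReal.ofReal_ne_top⟩) hm
  rw [ENNReal.toReal_add hν ENNReal.ofReal_ne_top, ENNReal.toReal_ofReal hε] at h2
  rw [integral_eq_lintegral_of_nonneg_ae (ae_of_all _ fun y => (hT01 y).1) hT.aestronglyMeasurable,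
    integral_eq_lintegral_of_nonneg_ae (ae_of_all _ fun y => (hT01 y).1) hT.aestronglyMeasurable]
  linarith

lemma isProbabilityMeasure_join_of_oblivious {X : Type*} [MeasurableSpace X] {D : Measure X}
    [IsProbabilityMeasure D] {ρ : X → X → ℝ≥0∞} {n : ℕ} {Q : Measure (Measure (Fin n → X))}
    [IsProbabilityMeasure Q] (hQ : ∀ᵐ E ∂Q, E ∈ obliviousCorruptions n ρ D) :
    IsProbabilityMeasure Q.join := by
  refine ⟨?_⟩
  rw [Measure.join_apply MeasurableSet.univ]
  calc ∫⁻ E, E Set.univ ∂Q = ∫⁻ _, 1 ∂Q := by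
        refine lintegral_congr_ae ?_
        filter_upwards [hQ] with E hE
        obtain ⟨D', ⟨π, ⟨h1, h2⟩, -⟩, rfl⟩ := hE
        have hπ : IsProbabilityMeasure π := by
          refine ⟨?_⟩
          rw [← Set.preimage_univ (f := (Prod.fst : X × X → X)),
            ← Measure.map_apply measurable_fst MeasurableSet.univ, h1, measure_univ]
        have : IsProbabilityMeasure D' := by
          rw [← h2]; exact Measure.isProbabilityMeasure_map measurable_snd.aemeasurable
        exact measure_univ
    _ = 1 := by simp

lemma pi_mem_obliviousCorruptions {X : Type*} [MeasurableSpace X] (D : Measure X)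
    {ρ : X → X → ℝ≥0∞} (hρ : IsCostFunction ρ)
    (hρm : Measurable (fun p : X × X => ρ p.1 p.2)) (n : ℕ) :
    Measure.pi (fun _ : Fin n => D) ∈ obliviousCorruptions n ρ D := by
  have hdiag : Measurable fun x : X => (x, x) := by fun_prop
  refine ⟨D, ⟨D.map fun x => (x, x), ⟨?_, ?_⟩, ?_⟩, rfl⟩
  · rw [Measure.map_map measurable_fst hdiag]; exact Measure.map_id
  · rw [Measure.map_map measurable_snd hdiag]; exact Measure.map_id
  · rw [lintegral_map hρm hdiag]
    simp [hρ _]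

lemma one_sub_natCast_sub_div {k m : ℕ} (hk : k < m) :
    (1 : ℝ≥0∞) - ((m - k : ℕ) : ℝ≥0∞) / m ≤ ENNReal.ofReal (k / m) := by
  have hm : (0 : ℝ) < m := by exact_mod_cast (by omega : 0 < m)
  have hk' : (k : ℝ) ≤ m := by exact_mod_cast hk.le
  rw [tsub_le_iff_right, ← ENNReal.ofReal_natCast (m - k), ← ENNReal.ofReal_natCast m,
    ← ENNReal.ofReal_div_of_pos hm, ← ENNReal.ofReal_add (by positivity) (by positivity),
    Nat.cast_sub hk.le, ← add_div, add_sub_cancel, div_self hm.ne', ENNReal.ofReal_one]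

/-- A sample corrupted in an exchangeable way, given with a kernel dominating it, is close to a
mixture of oblivious corruptions. -/
lemma IsExchangeableBelow.exists_oblivious_tvDist_le {X : Type*} [MeasurableSpace X]
    [StandardBorelSpace X] {D : Measure X} [IsProbabilityMeasure D] {ρ : X → X → ℝ≥0∞}
    {μ : Measure (ℕ → X × X)} [IsProbabilityMeasure μ] {m n d : ℕ} {ε : ℝ}
    (h : IsExchangeableBelow m μ) (hρ : IsCostFunction ρ)
    (hρm : Measurable (fun p : X × X => ρ p.1 p.2))
    (hμ : μ.map (fun z (i : Fin m) => (z i).1) = Measure.pi fun _ : Fin m => D)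
    (hcost : ∀ᵐ z ∂μ, ∑ i ∈ Finset.range m, ρ (z i).1 (z i).2 ≤ m) (hdeg : costDegree ρ ≤ d)
    (hd : 1 ≤ d) (hn : 0 < n) (hnm : n ≤ m) (hε : 0 < ε) (hε1 : ε ≤ 1)
    (hm : 4096 * ((n : ℝ) ^ 4 * Real.log d ^ 2 / ε ^ 4) ≤ m) :
    ∃ Q : Measure (Measure (Fin n → X)), IsProbabilityMeasure Q ∧
      (∀ᵐ E ∂Q, E ∈ obliviousCorruptions n ρ D) ∧
      tvDist (μ.map fun z (i : Fin n) => (z i).2) Q.join ≤ ε := by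
  have : Nonempty X := (nonempty_of_isProbabilityMeasure μ).map fun z => (z 0).1
  obtain ⟨κ, hκ, hκd⟩ := h.exists_kernel hcost hρm hdeg (by omega)
  have hdom : ∀ k l, k + l ≤ m → blockLaw Prod.fst μ k l ≤ (d : ℝ≥0∞) ^ k •
      (Measure.pi fun _ : Fin k => D ⊗ₘ κ).prod (Measure.pi fun _ : Fin l => D) :=
    fun k l hkl => blockLaw_fst_le hμ κ hκd hkl
  set a : ℕ → ℝ≥0∞ := fun k => klDiv (initialLaw μ k) (Measure.pi fun _ => D ⊗ₘ κ) with ha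
  have hlog : 0 ≤ Real.log d := Real.log_natCast_nonneg d
  have hale : ∀ k ≤ m, a k ≤ ENNReal.ofReal (k * Real.log d) := fun k hk => by
    -- The case of no further clean points bounds the divergence of the first `k` pairs alone.
    refine le_trans ?_ (klDiv_blockLaw_fst_le (l := 0) hd (hdom k 0 (by omega)))
    rw [klDiv_blockLaw_chain measurable_fst]
    exact le_self_add
  have hfin : ∀ k ≤ m, a k ≠ ∞ := fun k hk =>
    ne_top_of_le_ne_top ENNReal.ofReal_ne_top (hale k hk)
  set b : ℕ → ℝ≥0∞ := fun k => klDiv (pointLaw id μ k) ((initialLaw μ k).prod (D ⊗ₘ κ)) with hb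
  have hab : ∀ k, a (k + 1) = a k + b k := fun k => klDiv_pointLaw_eq_add (D ⊗ₘ κ)
  have hbfin : ∀ k < m, b k ≠ ∞ := fun k hk =>
    ne_top_of_le_ne_top (hfin (k + 1) hk) (by rw [hab]; exact le_add_self)
  have hbr : ∀ k < m, (a (k + 1)).toReal - (a k).toReal = (b k).toReal := fun k hk => by
    rw [hab, ENNReal.toReal_add (hfin k hk.le) (hbfin k hk), add_sub_cancel_left]
  obtain ⟨k, hkm, hkn, τ, hτ0, hτ, hbound⟩ := exists_index_of_superadditive
    (A := fun k => (a k).toReal) (L := Real.log d) (fun _ => ENNReal.toReal_nonneg)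
    (fun k hk => ENNReal.toReal_le_of_le_ofReal (by positivity) (hale k hk))
    (fun k l hk hkl => by
      have := ENNReal.toReal_mono (hfin (k + l) hkl)
        (h.mul_klDiv_pointLaw_le (D ⊗ₘ κ) hkl hk hfin)
      rw [ENNReal.toReal_add (hfin k hk.le)
        (ENNReal.mul_ne_top (ENNReal.natCast_ne_top l) (hbfin k hk)), ENNReal.toReal_mul,
        ENNReal.toReal_natCast] at this
      rw [hbr k hk]
      exact this)
    (fun k hk => by
      have := hbr k hk
      linarith [(ENNReal.toReal_nonneg : 0 ≤ (b k).toReal)])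
    hn hnm hε hε1 hm (by
      -- Either `d = 1` and the logarithm vanishes, or `d ≥ 2` and it is at least `log 2 > 1/2`.
      rcases hd.eq_or_lt with rfl | hd2
      · left; simp
      · right
        have h2 : Real.log 2 ≤ Real.log d := Real.log_le_log two_pos (by exact_mod_cast hd2)
        linarith [Real.log_two_gt_d9])
  have hτ' : a (k + n) ≤ a k + n * b k + ENNReal.ofReal τ := by
    rw [hbr k hkm] at hτ
    rw [← ENNReal.ofReal_toReal (hfin (k + n) hkn), ← ENNReal.ofReal_toReal (hfin k hkm.le),
      ← ENNReal.ofReal_toReal (hbfin k hkm), ← ENNReal.ofReal_natCast n,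
      ← ENNReal.ofReal_mul (by positivity), ← ENNReal.ofReal_add (by positivity) (by positivity),
      ← ENNReal.ofReal_add (by positivity) hτ0]
    exact ENNReal.ofReal_le_ofReal hτ
  obtain ⟨Q, hQ, hQobl, hQT⟩ := h.exists_oblivious hρ hρm hcost hd hdom hkm hkn hfin hτ'
  have hjoin := isProbabilityMeasure_join_of_oblivious hQobl
  have hadapt : IsProbabilityMeasure (μ.map fun z (i : Fin n) => (z i).2) :=
    Measure.isProbabilityMeasure_map
      (by fun_prop : Measurable fun (z : ℕ → X × X) (i : Fin n) => (z i).2).aemeasurable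
  refine ⟨Q, hQ, hQobl, tvDist_le_of_lintegral_le hε.le fun T hT hT1 => ?_⟩
  have hn' : (0 : ℝ) < n := by exact_mod_cast hn
  have hmk : (0 : ℝ) < (m : ℝ) - k := sub_pos.2 (by exact_mod_cast hkm)
  refine (hQT T hT hT1 (ε / 4) (ε / (8 * n)) (by positivity) (by positivity)).trans ?_
  gcongr
  refine le_trans ?_ (ENNReal.ofReal_le_ofReal hbound)
  have e1 : ENNReal.ofReal (k * Real.log d) / ((m - k : ℕ) : ℝ≥0∞)
      = ENNReal.ofReal (k * Real.log d / (m - k)) := by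
    rw [ENNReal.ofReal_div_of_pos hmk, ← Nat.cast_sub hkm.le, ENNReal.ofReal_natCast]
  rw [e1, ENNReal.ofReal_add (by positivity) (by positivity),
    ENNReal.ofReal_add (by positivity) (by positivity), ENNReal.ofReal_mul hτ0,
    ENNReal.ofReal_mul hn'.le, ENNReal.ofReal_natCast,
    ENNReal.ofReal_add (by positivity) (by positivity),
    ENNReal.ofReal_add (by positivity) (by positivity), ENNReal.ofReal_mul (by positivity)]
  gcongr
  exact one_sub_natCast_sub_div hkm

/-- When every test is within `ε`, the clean product itself is a valid oblivious corruption. -/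
lemma exists_oblivious_of_forall_lintegral_le {X : Type*} [MeasurableSpace X]
    [StandardBorelSpace X] (D : Measure X) [IsProbabilityMeasure D] {ρ : X → X → ℝ≥0∞}
    (hρ : IsCostFunction ρ) (hρm : Measurable (fun p : X × X => ρ p.1 p.2)) {n : ℕ} {ε : ℝ}
    (hε : 0 ≤ ε) (E : Measure (Fin n → X)) [IsProbabilityMeasure E]
    (h : ∀ T : (Fin n → X) → ℝ≥0∞, Measurable T → (∀ y, T y ≤ 1) →
      ∫⁻ y, T y ∂E ≤ ∫⁻ y, T y ∂(Measure.pi fun _ : Fin n => D) + ENNReal.ofReal ε) :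
    ∃ Q : Measure (Measure (Fin n → X)), IsProbabilityMeasure Q ∧
      (∀ᵐ E ∂Q, E ∈ obliviousCorruptions n ρ D) ∧ tvDist E Q.join ≤ ε := by
  -- Writing the Dirac mass as a pushforward lets `ae_map_measure_of_ae` apply without measurability
  -- of the set of oblivious corruptions.
  have hQ : D.map (fun _ => Measure.pi fun _ : Fin n => D)
      = Measure.dirac (Measure.pi fun _ : Fin n => D) := by
    rw [Measure.map_const, measure_univ, one_smul]
  refine ⟨Measure.dirac (Measure.pi fun _ : Fin n => D), inferInstance, ?_, ?_⟩
  · rw [← hQ]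
    exact ae_map_measure_of_ae D measurable_const (fun _ => inferInstance)
      (ae_of_all _ fun _ => pi_mem_obliviousCorruptions D hρ hρm n)
  · rw [Measure.join_dirac]
    exact tvDist_le_of_lintegral_le hε h

end Corruption

end

theorem mainTheorem2 :
    ∃ C : ℝ, 0 < C ∧
      ∀ (X : Type*) [MeasurableSpace X] [StandardBorelSpace X]
        (D : Measure X) [IsProbabilityMeasure D]
        (ρ : X → X → ℝ≥0∞),
        Corruption.IsCostFunction ρ → Measurable (fun p : X × X => ρ p.1 p.2) →
        ∀ (n d : ℕ) (ε : ℝ), Corruption.costDegree ρ = (d : ℕ∞) → 0 < ε →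
        ∀ m : ℕ, n ≤ m → C * ((n : ℝ) ^ 4 * (Real.log d) ^ 2 / ε ^ 4) ≤ (m : ℝ) →
        ∀ Dadaptive ∈ Corruption.subsample n '' Corruption.adaptiveCorruptions m ρ D,
        ∃ Q : Measure (Measure (Fin n → X)),
          IsProbabilityMeasure Q ∧
          (∀ᵐ E ∂Q, E ∈ Corruption.obliviousCorruptions n ρ D) ∧
          Corruption.tvDist Dadaptive Q.join ≤ ε := by
  refine ⟨4096, by norm_num, ?_⟩
  intro X _ _ D _ ρ hρ hρm n d ε hdeg hε m hnm hm Dadaptive hDadaptive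
  obtain ⟨E, ⟨π, ⟨hπ1, hπ2⟩, hπ⟩, rfl⟩ := hDadaptive
  obtain ⟨x₀⟩ : Nonempty X := nonempty_of_isProbabilityMeasure D
  have hπp : IsProbabilityMeasure π := by
    refine ⟨?_⟩
    rw [← Set.preimage_univ (f := (Prod.fst : (Fin m → X) × (Fin m → X) → Fin m → X)),
      ← Measure.map_apply measurable_fst MeasurableSet.univ, hπ1, measure_univ]
  rw [← hπ2, Corruption.subsample_eq_map_symmetrizedLaw (y₀ := (x₀, x₀)) hnm]
  set μ := Corruption.symmetrizedLaw (x₀, x₀) π with hμ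
  have hadapt : IsProbabilityMeasure (μ.map fun z (i : Fin n) => (z i).2) :=
    Measure.isProbabilityMeasure_map
      (by fun_prop : Measurable fun (z : ℕ → X × X) (i : Fin n) => (z i).2).aemeasurable
  -- For `n = 0` there is only one sample, and for `ε ≥ 1` every test is within `ε`; in both cases
  -- the clean product suffices.
  rcases Nat.eq_zero_or_pos n with rfl | hn
  · refine Corruption.exists_oblivious_of_forall_lintegral_le D hρ hρm hε.le _ fun T _ _ => ?_
    have hT : T = fun _ => T default := funext fun y => congrArg T (Subsingleton.elim _ _)
    rw [hT]
    simp
  rcases le_total 1 ε with hε1 | hε1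
  · refine Corruption.exists_oblivious_of_forall_lintegral_le D hρ hρm hε.le _ fun T _ hT1 => ?_
    calc _ ≤ ∫⁻ _, 1 ∂(μ.map fun z (i : Fin n) => (z i).2) := lintegral_mono hT1
      _ = ENNReal.ofReal 1 := by simp
      _ ≤ ENNReal.ofReal ε := ENNReal.ofReal_le_ofReal hε1
      _ ≤ _ := le_add_self
  have hd : 1 ≤ d := by
    have h1 : (1 : ℕ∞) ≤ Corruption.costDegree ρ := by
      refine le_trans ?_ (le_iSup (fun x : X => {y : X | ρ x y ≠ ∞}.encard) x₀)
      rw [Set.one_le_encard_iff_nonempty]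
      exact ⟨x₀, by simp [hρ x₀]⟩
    rw [hdeg] at h1
    exact_mod_cast h1
  exact Corruption.isExchangeableBelow_symmetrizedLaw.exists_oblivious_tvDist_le hρ hρm
    (Corruption.map_fst_symmetrizedLaw hπ1)
    (Corruption.ae_symmetrizedLaw_cost hρm (by omega) hπ) hdeg.le hd hn hnm hε hε1 hm
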